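/- Fix a relational schema with finitely many relation symbols, each attribute of which takes its values either in an infinite domain $D$ of uninterpreted constants or in a non-empty, linearly ordered numeric domain $N$. Elements of $D$ and of $N$ are represented injectively by binary strings, in such a way that the order of $N$ can be decided in polynomial time (as for $\mathbb N$, $\mathbb Z$, $\mathbb Q$ in binary notation). A database instance is a finite set of facts $P(\bar a)$, where the tuple $\bar a$ of constants respects the types of the attributes of $P$; it is given to a Turing machine as a list of its facts. A denial constraint is a sentence $$\forall \bar x_1\cdots\bar x_m.\ \neg[P_1(\bar x_1)\wedge\cdots\wedge P_m(\bar x_m)\wedge\varphi(\bar x_1,\ldots,\bar x_m)],$$ where the $P_i$ are relation symbols, the $\bar x_i$ are tuples of (typed) variables and constants, and $\varphi$ is a conjunction of built-in atoms (comparisons $=,\neq$ between terms of the same type and $<,\le,>,\ge$ between numeric terms) whose variables all occur in $\bar x_1,\ldots,\bar x_m$. Given a finite set $F$ of denial constraints, a repair of an instance $r$ is an instance $r'\subseteq r$ that satisfies $F$ and for which the set $r\setminus r'$ of deleted facts is inclusion-minimal among the sets $r\setminus s$, where $s$ ranges over the instances that satisfy $F$. A quantifier-free sentence $\Phi$ is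 a Boolean combination of ground relational atoms and ground built-in atoms; it is consistently true in $r$ if it is true in every repair of $r$. Let $$D_{F,\Phi}=\{r : \Phi \text{ is true in every repair of } r \text{ with respect to } F\}.$$ **Theorem.** For every finite set $F$ of denial constraints and every quantifier-free sentence $\Phi$, the set $D_{F,\Phi}$ is in PTIME (data complexity): for fixed schema, $F$ and $\Phi$, there is a deterministic Turing machine which, given an instance $r$, decides in time polynomial in the size of $r$ whether $r\in D_{F,\Phi}$. -/

import Mathlib

namespace CQA

/-- The two kinds of attributes: those with values in the database domain `D` of uninterpreted
constants, and those with values in the numeric domain `N`. -/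
inductive Kind : Type
  | db
  | num

/-- The domain of an attribute of a given kind. -/
def Val (D N : Type) : Kind → Type
  | .db => D
  | .num => N

/-- A relational database schema: finitely many relation symbols, each with an arity and a kind
for each of its attributes. -/
structure Schema : Type 1 where
  Rel : Type
  [finiteRel : Fintype Rel]
  arity : Rel → ℕ
  kind : (P : Rel) → Fin (arity P) → Kind

/-- Relational atoms `P(t₁, …, tₙ)` whose arguments are drawn from `T`; the `i`-th argument has the
kind of the `i`-th attribute of `P`. -/
structure RelAtom (S : Schema) (T : Kind → Type) : Type where
  rel : S.Rel
  args : (i : Fin (S.arity rel)) → T (S.kind rel i)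

/-- Built-in atoms: `=` and `≠` between arguments of the same kind, and `<, ≤, >, ≥` between
numeric arguments. -/
inductive BuiltinAtom (T : Kind → Type) : Type
  | eq (k : Kind) (s t : T k)
  | ne (k : Kind) (s t : T k)
  | lt (s t : T .num)
  | le (s t : T .num)
  | gt (s t : T .num)
  | ge (s t : T .num)

/-- Terms of a kind: variables (each kind has its own supply, indexed by `ℕ`) and constants. -/
inductive Term (D N : Type) (k : Kind) : Type
  | var (n : ℕ)
  | const (c : Val D N k)

/-- Facts, i.e. ground relational atoms. -/
abbrev Fact (S : Schema) (D N : Type) : Type := RelAtom S (Val D N)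

/-- A database instance is identified with its finite set of facts. -/
abbrev Instance (S : Schema) (D N : Type) : Type := Finset (Fact S D N)

/-! ### Substitution and truth of atoms -/

/-- A valuation (substitution) assigns to each variable a value of its kind. -/
abbrev Valuation (D N : Type) : Type := (k : Kind) → ℕ → Val D N k

def Term.subst {D N : Type} {k : Kind} (ρ : Valuation D N) : Term D N k → Val D N k
  | .var n => ρ k n
  | .const c => c

/-- The variables of a term; a variable is recorded together with its kind. -/
def Term.vars {D N : Type} {k : Kind} : Term D N k → Set (Kind × ℕ)
  | .var n => {(k, n)}
  | .const _ => ∅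

def RelAtom.subst {S : Schema} {D N : Type} (ρ : Valuation D N) (a : RelAtom S (Term D N)) :
    Fact S D N :=
  ⟨a.rel, fun i => (a.args i).subst ρ⟩

def RelAtom.vars {S : Schema} {D N : Type} (a : RelAtom S (Term D N)) : Set (Kind × ℕ) :=
  ⋃ i, (a.args i).vars

def BuiltinAtom.subst {D N : Type} (ρ : Valuation D N) :
    BuiltinAtom (Term D N) → BuiltinAtom (Val D N)
  | .eq k s t => .eq k (s.subst ρ) (t.subst ρ)
  | .ne k s t => .ne k (s.subst ρ) (t.subst ρ)
  | .lt s t => .lt (s.subst ρ) (t.subst ρ)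
  | .le s t => .le (s.subst ρ) (t.subst ρ)
  | .gt s t => .gt (s.subst ρ) (t.subst ρ)
  | .ge s t => .ge (s.subst ρ) (t.subst ρ)

def BuiltinAtom.vars {D N : Type} : BuiltinAtom (Term D N) → Set (Kind × ℕ)
  | .eq _ s t => s.vars ∪ t.vars
  | .ne _ s t => s.vars ∪ t.vars
  | .lt s t => s.vars ∪ t.vars
  | .le s t => s.vars ∪ t.vars
  | .gt s t => s.vars ∪ t.vars
  | .ge s t => s.vars ∪ t.vars

/-- Truth of a ground built-in atom. -/
def BuiltinAtom.Holds {D N : Type} [LinearOrder N] : BuiltinAtom (Val D N) → Prop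
  | .eq _ s t => s = t
  | .ne _ s t => s ≠ t
  | .lt s t => @LT.lt N _ s t
  | .le s t => @LE.le N _ s t
  | .gt s t => @LT.lt N _ t s
  | .ge s t => @LE.le N _ t s

/-! ### Denial constraints and ground sentences -/

/-- A denial constraint `∀ x̄₁ … x̄ₘ. ¬[P₁(x̄₁) ∧ ⋯ ∧ Pₘ(x̄ₘ) ∧ φ(x̄₁, …, x̄ₘ)]`, where the `x̄ᵢ` are tuples
of variables and constants and `φ` is a conjunction of built-in atoms whose variables all occur
among the `x̄ᵢ`. -/
structure DenialConstraint (S : Schema) (D N : Type) : Type where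
  atoms : List (RelAtom S (Term D N))
  builtins : List (BuiltinAtom (Term D N))
  safe : ∀ b ∈ builtins, ∀ v ∈ b.vars, ∃ a ∈ atoms, v ∈ a.vars

/-- The constraint `c` is true in the instance `r`. -/
def DenialConstraint.Holds {S : Schema} {D N : Type} [LinearOrder N]
    (c : DenialConstraint S D N) (r : Instance S D N) : Prop :=
  ∀ ρ : Valuation D N,
    ¬ ((∀ a ∈ c.atoms, a.subst ρ ∈ r) ∧ ∀ b ∈ c.builtins, (b.subst ρ).Holds)

/-- Quantifier-free sentences: Boolean combinations of ground relational and built-in atoms. -/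
inductive GroundSentence (S : Schema) (D N : Type) : Type
  | fact (a : Fact S D N)
  | builtin (b : BuiltinAtom (Val D N))
  | not (φ : GroundSentence S D N)
  | and (φ ψ : GroundSentence S D N)
  | or (φ ψ : GroundSentence S D N)

/-- The sentence is true in the instance `r`. -/
def GroundSentence.Holds {S : Schema} {D N : Type} [LinearOrder N] (r : Instance S D N) :
    GroundSentence S D N → Prop
  | .fact a => a ∈ r
  | .builtin b => b.Holds
  | .not φ => ¬ φ.Holds r
  | .and φ ψ => φ.Holds r ∧ ψ.Holds r
  | .or φ ψ => φ.Holds r ∨ ψ.Holds r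

/-! ### Repairs and consistent query answers -/

/-- `r` satisfies all constraints of `F`. -/
def Consistent {S : Schema} {D N : Type} [LinearOrder N]
    (F : Finset (DenialConstraint S D N)) (r : Instance S D N) : Prop :=
  ∀ c ∈ F, c.Holds r

/-- The distance `Δ⁻(r, r')`: the facts of `r` that are missing in `r'`. -/
def deletions {S : Schema} {D N : Type} (r r' : Instance S D N) : Set (Fact S D N) :=
  (r : Set (Fact S D N)) \ (r' : Set (Fact S D N))

/-- `r'` is a repair of `r`: it is obtained from `r` by deleting facts, it is consistent, and its
distance from `r` is minimal (for inclusion) among the consistent instances. -/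
def IsRepair {S : Schema} {D N : Type} [LinearOrder N]
    (F : Finset (DenialConstraint S D N)) (r r' : Instance S D N) : Prop :=
  r' ⊆ r ∧ Consistent F r' ∧
    ∀ s : Instance S D N, Consistent F s →
      deletions r s ⊆ deletions r r' → deletions r r' ⊆ deletions r s

/-- The set `D_{F,Φ}` of the instances in which `Φ` is consistently true, i.e. all of whose repairs
with respect to `F` satisfy `Φ`. -/
def consistentAnswers {S : Schema} {D N : Type} [LinearOrder N]
    (F : Finset (DenialConstraint S D N)) (Φ : GroundSentence S D N) : Set (Instance S D N) :=
  {r | ∀ r', IsRepair F r r' → Φ.Holds r'}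

/-! ### Polynomial time -/

open Classical in
/-- The decision problem `A`, on inputs `x` written as the string `enc x`, is decided by a
deterministic (multi-stack) Turing machine in time polynomial in the length of `enc x`. -/
def InPTIME {α Γ : Type} (enc : α → List Γ) (A : Set α) : Prop :=
  Nonempty (Turing.TM2ComputableInPolyTime enc Computability.encodeBool
    (fun x => decide (x ∈ A)))

/-- A pair of binary strings, written with a separator in between. -/
def encodePair {N : Type} (encN : N → List Bool) (p : N × N) : List (Option Bool) :=
  (encN p.1).map some ++ none :: (encN p.2).map some

/-- The finite alphabet in which instances are written. -/
inductive Symb (S : Schema) : Type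
  | rel (P : S.Rel)
  | bit (b : Bool)
  | sep

def encodeVal {D N : Type} (encD : D → List Bool) (encN : N → List Bool) :
    (k : Kind) → Val D N k → List Bool
  | .db, v => encD v
  | .num, v => encN v

/-- The fact `P(v₁, …, vₙ)` is written as the symbol `P` followed by the binary representations of
`v₁, …, vₙ`, each closed by a separator. -/
def encodeFact {S : Schema} {D N : Type} (encD : D → List Bool) (encN : N → List Bool)
    (a : Fact S D N) : List (Symb S) :=
  Symb.rel a.rel :: (List.finRange (S.arity a.rel)).flatMap fun i =>
    (encodeVal encD encN (S.kind a.rel i) (a.args i)).map Symb.bit ++ [Symb.sep]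

/-- A list of facts is written by concatenating its facts. -/
def encodeFacts {S : Schema} {D N : Type} (encD : D → List Bool) (encN : N → List Bool)
    (l : List (Fact S D N)) : List (Symb S) :=
  l.flatMap (encodeFact encD encN)

open Classical in
/-- The set `A` of instances is decidable in polynomial time: the machine is given any list of the
facts of an instance (in any order, repetitions being allowed), and decides whether that instance
belongs to `A`. -/
def InstancesInPTIME {S : Schema} {D N : Type} (encD : D → List Bool) (encN : N → List Bool)
    (A : Set (Instance S D N)) : Prop :=
  InPTIME (encodeFacts encD encN) {l : List (Fact S D N) | l.toFinset ∈ A}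

end CQA

namespace CQA

open Function Turing

/-! ### Reachability in a bounded number of steps -/

/-- `b` is reached from `a` by at most `t` iterations of the partial function `f`. -/
def ReachIn {C : Type} (f : C → Option C) (a b : C) (t : ℕ) : Prop :=
  ∃ n ≤ t, (flip bind f)^[n] (some a) = some b

namespace ReachIn

variable {C : Type} {f : C → Option C} {a b c : C} {t t' : ℕ}

theorem refl (a : C) : ReachIn f a a 0 := ⟨0, le_rfl, rfl⟩

theorem trans (h : ReachIn f a b t) (h' : ReachIn f b c t') : ReachIn f a c (t + t') := by
  obtain ⟨n, hn, e⟩ := h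
  obtain ⟨n', hn', e'⟩ := h'
  refine ⟨n' + n, by omega, ?_⟩
  rw [iterate_add_apply, e, e']

theorem mono (h : ReachIn f a b t) (htt : t ≤ t') : ReachIn f a b t' :=
  let ⟨n, hn, e⟩ := h
  ⟨n, hn.trans htt, e⟩

theorem single (h : f a = some b) : ReachIn f a b 1 := ⟨1, le_rfl, h⟩

theorem step (h : f a = some b) (h' : ReachIn f b c t) : ReachIn f a c (t + 1) := by
  rw [add_comm]
  exact (single h).trans h'

end ReachIn

theorem iterate_bind_none {C : Type} (f : C → Option C) (n : ℕ) :
    (flip bind f)^[n] none = none := by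
  induction n with
  | zero => rfl
  | succ n ih => rw [iterate_succ_apply]; exact ih

/-! ### Register programs -/

/-- Contents of the registers; each register is a stack. -/
abbrev Regs (G : Type) : Type := ℕ → List G

/-- Structured programs on registers; a register is a stack over the alphabet `G`. -/
inductive Prog (G : Type) : Type
  /-- push a symbol -/
  | push (i : ℕ) (g : G)
  /-- pop a symbol from a nonempty register and push it on each register of a list -/
  | xfer (i : ℕ) (js : List ℕ)
  | seq (p q : Prog G)
  /-- branch on the top symbols of two registers -/
  | ite (i j : ℕ) (f : Option G → Option G → Bool) (p q : Prog G)
  | loop (i j : ℕ) (f : Option G → Option G → Bool) (p : Prog G)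
  /-- query the oracle on the content of register `i`, push its answer on register `j` -/
  | call (i j : ℕ)

/-- Push the string `x` (its last symbol becomes the bottom one) on each register of the list. -/
def pushAll {G : Type} (S : Regs G) (js : List ℕ) (x : List G) : Regs G :=
  fun r => if r ∈ js then x ++ S r else S r

namespace Prog

variable {G : Type}

/-- All registers mentioned in the program are smaller than `m`. -/
def Below (m : ℕ) : Prog G → Prop
  | push i _ => i < m
  | xfer i js => i < m ∧ ∀ j ∈ js, j < m
  | seq p q => p.Below m ∧ q.Below m
  | ite i j _ p q => i < m ∧ j < m ∧ p.Below m ∧ q.Below m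
  | loop i j _ p => i < m ∧ j < m ∧ p.Below m
  | call i j => i < m ∧ j < m

theorem Below.mono {m n : ℕ} (hmn : m ≤ n) {p : Prog G} (h : p.Below m) : p.Below n := by
  induction p with
  | push => exact lt_of_lt_of_le h hmn
  | xfer => exact ⟨h.1.trans_le hmn, fun j hj => (h.2 j hj).trans_le hmn⟩
  | seq p q hp hq => exact ⟨hp h.1, hq h.2⟩
  | ite i j f p q hp hq =>
    exact ⟨h.1.trans_le hmn, h.2.1.trans_le hmn, hp h.2.2.1, hq h.2.2.2⟩
  | loop i j f p hp => exact ⟨h.1.trans_le hmn, h.2.1.trans_le hmn, hp h.2.2⟩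
  | call => exact ⟨h.1.trans_le hmn, h.2.trans_le hmn⟩

theorem exists_below (p : Prog G) : ∃ m, p.Below m := by
  induction p with
  | push i => exact ⟨i + 1, Nat.lt_succ_self i⟩
  | xfer i js =>
    refine ⟨i + js.sum + 1, by omega, fun j hj => ?_⟩
    have := List.le_sum_of_mem hj
    omega
  | seq p q hp hq =>
    obtain ⟨m, hm⟩ := hp
    obtain ⟨n, hn⟩ := hq
    exact ⟨m + n, hm.mono (by omega), hn.mono (by omega)⟩
  | ite i j f p q hp hq =>
    obtain ⟨m, hm⟩ := hp
    obtain ⟨n, hn⟩ := hq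
    exact ⟨i + j + m + n + 1, by omega, by omega, hm.mono (by omega), hn.mono (by omega)⟩
  | loop i j f p hp =>
    obtain ⟨m, hm⟩ := hp
    exact ⟨i + j + m + 1, by omega, by omega, hm.mono (by omega)⟩
  | call i j => exact ⟨i + j + 1, by omega, by omega⟩

/-- `Runs O p S S' t`: started in `S`, the program `p` ends in `S'`, in time at most `t`. Here
`O s g t` says that the oracle answers the query `s` with `g` in time `t`. -/
inductive Runs (O : List G → G → ℕ → Prop) : Prog G → Regs G → Regs G → ℕ → Prop
  | push (i g S) : Runs O (push i g) S (update S i (g :: S i)) 1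
  | xfer {i js S g s} (hS : S i = g :: s) (hi : i ∉ js) (hjs : js.Nodup) :
      Runs O (xfer i js) S (pushAll (update S i s) js [g]) 1
  | seq {p q S S' S'' t t'} : Runs O p S S' t → Runs O q S' S'' t' →
      Runs O (seq p q) S S'' (t + t')
  | ite_true {i j f p q S S' t} : f (S i).head? (S j).head? = true → Runs O p S S' t →
      Runs O (ite i j f p q) S S' (t + 1)
  | ite_false {i j f p q S S' t} : f (S i).head? (S j).head? = false → Runs O q S S' t →
      Runs O (ite i j f p q) S S' (t + 1)
  | loop_true {i j f p S S' S'' t t'} : f (S i).head? (S j).head? = true → Runs O p S S' t →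
      Runs O (loop i j f p) S' S'' t' → Runs O (loop i j f p) S S'' (t + t' + 1)
  | loop_false {i j f p S} : f (S i).head? (S j).head? = false → Runs O (loop i j f p) S S 1
  | call {i j S g t} (hij : i ≠ j) : O (S i) g t →
      Runs O (call i j) S (update (update S i []) j (g :: S j)) t
  | mono {p S S' t t'} : Runs O p S S' t → t ≤ t' → Runs O p S S' t'

end Prog

/-! ### Compilation to Turing machines -/

namespace Compile

open Turing.TM2

variable {G : Type} (M : FinTM2) (m : ℕ) (inp : G → M.Γ M.k₀) (outp : M.Γ M.k₁ → G)

/-- The oracle computed by the machine `M`, which reads its query in reverse. -/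
def oracle (s : List G) (g : G) (t : ℕ) : Prop :=
  ∃ o u, Nonempty (TM2OutputsInTime M (s.reverse.map inp) (some [o]) u) ∧ g = outp o ∧
    t = s.length + u + 2

/-- The stacks: the registers, the stacks of `M`, and an output stack. -/
abbrev Stacks : Type := Fin m ⊕ (M.K ⊕ Unit)

/-- The stack alphabets. -/
@[reducible] def Alph (G : Type) (M : FinTM2) (m : ℕ) : Stacks M m → Type
  | .inl _ => G
  | .inr (.inl k) => M.Γ k
  | .inr (.inr _) => Bool

/-- The internal states: a buffer for two symbols and the state of `M`. -/
abbrev State (G : Type) (M : FinTM2) : Type := (Option G × Option G) × M.σ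

/-- The statements of the compiled machine, for the type `L` of labels. -/
abbrev Code (G : Type) (M : FinTM2) (m : ℕ) (L : Type) : Type := Stmt (Alph G M m) L (State G M)

/-- Empty the buffer and jump. -/
def jump {L : Type} (l : L) : Code G M m L :=
  .load (fun v => ((none, none), v.2)) (.goto fun _ => l)

theorem stepAux_jump {L : Type} (l : L) (b : Option G × Option G) (v : M.σ)
    (T : ∀ k, List (Alph G M m k)) :
    stepAux (jump M m l) (b, v) T = ⟨some l, ((none, none), v), T⟩ := rfl

/-- The statements of `M` as statements of the compiled machine; `emb` embeds the labels, and `M`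
halts by jumping to `ex`. -/
def lift (G : Type) (M : FinTM2) (m : ℕ) {L : Type} (emb : M.Λ → L) (ex : L) :
    Stmt M.Γ M.Λ M.σ → Code G M m L
  | .push k f q => .push (.inr (.inl k)) (fun v => f v.2) (lift G M m emb ex q)
  | .peek k f q => .peek (.inr (.inl k)) (fun v x => (v.1, f v.2 x)) (lift G M m emb ex q)
  | .pop k f q => .pop (.inr (.inl k)) (fun v x => (v.1, f v.2 x)) (lift G M m emb ex q)
  | .load a q => .load (fun v => (v.1, a v.2)) (lift G M m emb ex q)
  | .branch f q q' => .branch (fun v => f v.2) (lift G M m emb ex q) (lift G M m emb ex q')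
  | .goto l => .goto fun v => emb (l v.2)
  | .halt => .goto fun _ => ex

/-- The labels used by a program. -/
def Label (M : FinTM2) : Prog G → Type
  | .push _ _ => Unit
  | .xfer _ _ => Unit
  | .seq p q => Label M p ⊕ Label M q
  | .ite _ _ _ p q => Option (Label M p ⊕ Label M q)
  | .loop _ _ _ p => Option (Label M p)
  | .call _ _ => Option (Option M.Λ)

noncomputable instance Label.fintype (p : Prog G) : Fintype (Label M p) := by
  have := M.ΛFin
  induction p with
  | push => exact inferInstanceAs (Fintype Unit)
  | xfer => exact inferInstanceAs (Fintype Unit)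
  | seq p q hp hq => exact inferInstanceAs (Fintype (Label M p ⊕ Label M q))
  | ite _ _ _ p q hp hq => exact inferInstanceAs (Fintype (Option (Label M p ⊕ Label M q)))
  | loop _ _ _ p hp => exact inferInstanceAs (Fintype (Option (Label M p)))
  | call => exact inferInstanceAs (Fintype (Option (Option M.Λ)))

/-- The label at which a program starts. -/
def entry : (p : Prog G) → Label M p
  | .push _ _ => ()
  | .xfer _ _ => ()
  | .seq p _ => Sum.inl (entry p)
  | .ite _ _ _ _ _ => (none : Option _)
  | .loop _ _ _ _ => (none : Option _)
  | .call _ _ => (none : Option _)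

/-- Assemble the stack contents. -/
def stk (R : Fin m → List G) (T : ∀ k, List (M.Γ k)) (o : List Bool) :
    ∀ k, List (Alph G M m k)
  | .inl i => R i
  | .inr (.inl k) => T k
  | .inr (.inr _) => o

section stk

variable {M m}

theorem update_stk_reg (R : Fin m → List G) (T : ∀ k, List (M.Γ k)) (o : List Bool) (i : Fin m)
    (x : List G) : update (stk M m R T o) (.inl i) x = stk M m (update R i x) T o := by
  funext k
  rcases k with k | k | k
  · by_cases h : k = i
    · subst h; simp [stk]
    · have h' : (Sum.inl k : Stacks M m) ≠ .inl i := by simpa using h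
      rw [update_of_ne h']; simp [stk, update_of_ne h]
  · rfl
  · rfl

theorem update_stk_machine (R : Fin m → List G) (T : ∀ k, List (M.Γ k)) (o : List Bool) (i : M.K)
    (x : List (M.Γ i)) :
    update (stk M m R T o) (.inr (.inl i)) x = stk M m R (update T i x) o := by
  funext k
  rcases k with k | k | k
  · rfl
  · by_cases h : k = i
    · subst h; simp [stk]
    · have h' : (Sum.inr (Sum.inl k) : Stacks M m) ≠ .inr (.inl i) := by simpa using h
      rw [update_of_ne h']; simp [stk, update_of_ne h]
  · rfl

theorem update_stk_out (R : Fin m → List G) (T : ∀ k, List (M.Γ k)) (o x : List Bool) :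
    update (stk M m R T o) (.inr (.inr ())) x = stk M m R T x := by
  funext k
  rcases k with k | k | k
  · rfl
  · rfl
  · simp [stk]

end stk

/-- The configuration of the compiled machine that corresponds to one of `M`. -/
def liftCfg {L : Type} (emb : M.Λ → L) (ex : L) (R : Fin m → List G) (c : M.Cfg) :
    Cfg (Alph G M m) L (State G M) :=
  ⟨some (c.l.elim ex emb), ((none, none), c.var), stk M m R c.stk []⟩

theorem stepAux_lift {L : Type} (emb : M.Λ → L) (ex : L) (q : Stmt M.Γ M.Λ M.σ) (v : M.σ)
    (R : Fin m → List G) (T : ∀ k, List (M.Γ k)) :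
    stepAux (lift G M m emb ex q) ((none, none), v) (stk M m R T []) =
      liftCfg M m emb ex R (stepAux q v T) := by
  induction q generalizing v T with
  | push k f q ih => simp only [lift, stepAux, update_stk_machine]; exact ih _ _
  | peek k f q ih => simp only [lift, stepAux]; exact ih _ _
  | pop k f q ih => simp only [lift, stepAux, update_stk_machine]; exact ih _ _
  | load a q ih => simp only [lift, stepAux]; exact ih _ _
  | branch f q q' ih ih' =>
    simp only [lift, stepAux]
    cases f v
    · exact ih' _ _
    · exact ih _ _
  | goto l => rfl
  | halt => rfl

theorem reachIn_lift {L : Type} (P : L → Code G M m L) (emb : M.Λ → L) (ex : L)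
    (hP : ∀ l, P (emb l) = lift G M m emb ex (M.m l)) (R : Fin m → List G) (n : ℕ) (c c' : M.Cfg)
    (hc : (flip bind M.step)^[n] (some c) = some c') :
    ReachIn (TM2.step P) (liftCfg M m emb ex R c) (liftCfg M m emb ex R c') n := by
  induction n generalizing c with
  | zero =>
    cases hc
    exact ReachIn.refl _
  | succ n ih =>
    rw [iterate_succ_apply] at hc
    obtain ⟨l, v, T⟩ := c
    cases l with
    | none =>
      have : flip bind M.step (some (⟨none, v, T⟩ : M.Cfg)) = none := rfl
      rw [this, iterate_bind_none] at hc
      cases hc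
    | some l =>
      have : flip bind M.step (some (⟨some l, v, T⟩ : M.Cfg)) = some (stepAux (M.m l) v T) := rfl
      rw [this] at hc
      refine ReachIn.step ?_ (ih _ hc)
      simp only [liftCfg, TM2.step, Option.elim, hP, stepAux_lift]

theorem initList_eq (s : List (M.Γ M.k₀)) :
    initList M s = ⟨some M.main, M.initialState, update (fun _ => []) M.k₀ s⟩ := by
  unfold initList
  congr 1
  funext k
  by_cases h : k = M.k₀
  · subst h; simp
  · simp [h]

theorem haltList_eq (s : List (M.Γ M.k₁)) :
    haltList M s = ⟨none, M.initialState, update (fun _ => []) M.k₁ s⟩ := by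
  unfold haltList
  congr 1
  funext k
  by_cases h : k = M.k₁
  · subst h; simp
  · simp [h]

theorem step_eq_some {K L σ : Type} [DecidableEq K] {Γ : K → Type} {P : L → Stmt Γ L σ} {l : L}
    {q : Stmt Γ L σ} (h : P l = q) {v : σ} {T : ∀ k, List (Γ k)} {c : Cfg Γ L σ}
    (hc : stepAux q v T = c) : TM2.step P ⟨some l, v, T⟩ = some c := by
  rw [← hc, ← h]
  rfl

variable [NeZero m]

/-- The index of a register. -/
def idx (i : ℕ) : Fin m := Fin.ofNat m i

/-- The stack of a register. -/
def reg (i : ℕ) : Stacks M m := .inl (idx m i)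

/-- The stack contents of the registers. -/
def regs (S : Regs G) : Fin m → List G := fun i => S i

theorem regs_apply (S : Regs G) {i : ℕ} (hi : i < m) : regs m S (idx m i) = S i := by
  simp [regs, idx, Nat.mod_eq_of_lt hi]

theorem update_regs (S : Regs G) {i : ℕ} (hi : i < m) (x : List G) :
    update (regs m S) (idx m i) x = regs m (update S i x) := by
  funext k
  have h : k = idx m i ↔ (k : ℕ) = i := by
    rw [Fin.ext_iff]; simp [idx, Nat.mod_eq_of_lt hi]
  simp [regs, update_apply, h]

/-- The configuration at a label in which the registers have the given contents and all else is
at rest. -/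
def cfg {L : Type} (l : L) (S : Regs G) : Cfg (Alph G M m) L (State G M) :=
  ⟨some l, ((none, none), M.initialState), stk M m (regs m S) (fun _ => []) []⟩

/-- Read the top symbols of two registers, then branch. -/
def test {L : Type} (i j : ℕ) (f : Option G → Option G → Bool) (l l' : L) : Code G M m L :=
  .peek (reg M m i) (fun v x => ((x, none), v.2))
    (.peek (reg M m j) (fun v x => ((v.1.1, x), v.2))
      (.branch (fun v => f v.1.1 v.1.2) (jump M m l) (jump M m l')))

theorem stepAux_test {L : Type} (i j : ℕ) (hi : i < m) (hj : j < m)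
    (f : Option G → Option G → Bool) (l l' : L) (S : Regs G) :
    stepAux (test M m i j f l l') ((none, none), M.initialState)
      (stk M m (regs m S) (fun _ => []) []) =
      cfg M m (bif f (S i).head? (S j).head? then l else l') S := by
  simp only [test, stepAux, reg, stk, regs_apply m S hi, regs_apply m S hj]
  cases f (S i).head? (S j).head? <;> rfl

variable [Inhabited G]

/-- Push the buffered symbol on each register of the list. -/
def pushBuffer {L : Type} : List ℕ → Code G M m L → Code G M m L
  | [], q => q
  | j :: js, q => .push (reg M m j) (fun v => v.1.1.getD default) (pushBuffer js q)

/-- The compiled code of a program; `emb` embeds its labels, `ex` is the label of what follows. -/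
def code {L : Type} : (p : Prog G) → (Label M p → L) → L → Label M p → Code G M m L
  | .push i g, _, ex, _ => .push (reg M m i) (fun _ => g) (jump M m ex)
  | .xfer i js, _, ex, _ => .pop (reg M m i) (fun v x => ((x, none), v.2))
      (pushBuffer M m js (jump M m ex))
  | .seq p q, emb, _, .inl l =>
      code p (fun x => emb (Sum.inl x)) (emb (Sum.inr (entry M q))) l
  | .seq _ q, emb, ex, .inr l => code q (fun x => emb (Sum.inr x)) ex l
  | .ite i j f p q, emb, _, none =>
      test M m i j f (emb (some (.inl (entry M p)))) (emb (some (.inr (entry M q))))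
  | .ite _ _ _ p _, emb, ex, some (.inl l) => code p (fun x => emb (some (.inl x))) ex l
  | .ite _ _ _ _ q, emb, ex, some (.inr l) => code q (fun x => emb (some (.inr x))) ex l
  | .loop i j f p, emb, ex, none => test M m i j f (emb (some (entry M p))) ex
  | .loop _ _ _ p, emb, _, some l => code p (fun x => emb (some x)) (emb (none : Option _)) l
  | .call i _, emb, _, none => .pop (reg M m i) (fun v x => ((x, none), v.2))
      (.branch (fun v => v.1.1.isSome)
        (.push (.inr (.inl M.k₀)) (fun v => inp (v.1.1.getD default))
          (jump M m (emb (none : Option _))))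
        (jump M m (emb (some (some M.main)))))
  | .call _ j, _, ex, some none =>
      .pop (.inr (.inl M.k₁)) (fun v x => ((x.map outp, none), v.2))
        (pushBuffer M m [j] (jump M m ex))
  | .call _ _, emb, _, some (some l) =>
      lift G M m (fun x => emb (some (some x))) (emb (some (none : Option _))) (M.m l)

theorem stepAux_pushBuffer {L : Type} (js : List ℕ) (hjs : ∀ j ∈ js, j < m) (hn : js.Nodup)
    (q : Code G M m L) (g : G) (b : Option G) (v : M.σ) (S : Regs G)
    (T : ∀ k, List (M.Γ k)) (o : List Bool) :
    stepAux (pushBuffer M m js q) ((some g, b), v) (stk M m (regs m S) T o) =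
      stepAux q ((some g, b), v) (stk M m (regs m (pushAll S js [g])) T o) := by
  induction js generalizing S with
  | nil =>
    have : pushAll S [] [g] = S := by funext r; simp [pushAll]
    rw [this]
    rfl
  | cons j js ih =>
    have hj := hjs j (by simp)
    rw [List.nodup_cons] at hn
    have e : pushAll (update S j (g :: S j)) js [g] = pushAll S (j :: js) [g] := by
      funext r
      by_cases h : r = j
      · subst h; simp [pushAll, hn.1]
      · simp [pushAll, h]
    simp only [pushBuffer, stepAux, reg, update_stk_reg, Option.getD_some]
    rw [← e, ← ih (fun j hj => hjs j (by simp [hj])) hn.2, ← update_regs m S hj]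
    simp [stk, regs_apply m S hj]

/-- The loop that hands a query over to `M`. -/
theorem reachIn_transfer {L : Type} (P : L → Code G M m L) (l l' : L) (i : ℕ) (hi : i < m)
    (hP : P l = .pop (reg M m i) (fun v x => ((x, none), v.2))
      (.branch (fun v => v.1.1.isSome)
        (.push (.inr (.inl M.k₀)) (fun v => inp (v.1.1.getD default)) (jump M m l))
        (jump M m l')))
    (s : List G) (S : Regs G) (hS : S i = s) (y : List (M.Γ M.k₀)) :
    ReachIn (TM2.step P)
      ⟨some l, ((none, none), M.initialState),
        stk M m (regs m S) (update (fun _ => []) M.k₀ y) []⟩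
      ⟨some l', ((none, none), M.initialState),
        stk M m (regs m (update S i [])) (update (fun _ => []) M.k₀ (s.reverse.map inp ++ y)) []⟩
      (s.length + 1) := by
  induction s generalizing S y with
  | nil =>
    refine ReachIn.single ?_
    simp only [TM2.step, hP, stepAux, stk, reg, update_stk_reg, regs_apply m S hi, hS,
      update_regs m S hi]
    rfl
  | cons g s ih =>
    have := ih (update S i s) (by simp) (inp g :: y)
    rw [update_idem] at this
    refine ReachIn.step ?_ (by simpa using this)
    simp only [TM2.step, hP, stepAux, stk, reg, update_stk_reg, regs_apply m S hi, hS,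
      update_regs m S hi, update_stk_machine]
    simp [jump]

/-- The compiled code simulates the program. -/
theorem reachIn_code {L : Type} (P : L → Code G M m L) {p : Prog G} {S S' : Regs G} {t : ℕ}
    (h : p.Runs (oracle M inp outp) S S' t) (hp : p.Below m) (emb : Label M p → L) (ex : L)
    (hP : ∀ l, P (emb l) = code M m inp outp p emb ex l) :
    ReachIn (TM2.step P) (cfg M m (emb (entry M p)) S) (cfg M m ex S') t := by
  induction h generalizing ex with
  | push i g S =>
    refine ReachIn.single (step_eq_some (hP ()) ?_)
    simp only [code, cfg, stepAux, reg, update_stk_reg, stepAux_jump]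
    rw [← update_regs m S hp]
    simp [stk, regs_apply m S hp]
  | @xfer i js S g s hS hi hjs =>
    refine ReachIn.single (step_eq_some (hP ()) ?_)
    simp only [code, cfg, stepAux, reg, update_stk_reg,
      regs_apply m S hp.1, hS, stk, update_regs m S hp.1, List.head?, List.tail]
    rw [stepAux_pushBuffer _ _ _ hp.2 hjs, stepAux_jump]
  | @seq p q S S' S'' t t' h h' ih ih' =>
    exact (ih hp.1 (fun x => emb (Sum.inl x)) (emb (Sum.inr (entry M q)))
      fun l => hP (.inl l)).trans (ih' hp.2 (fun x => emb (Sum.inr x)) ex fun l => hP (.inr l))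
  | @ite_true i j f p q S S' t hf h ih =>
    refine ReachIn.step (step_eq_some (hP (none : Option _))
      ((stepAux_test M m i j hp.1 hp.2.1 f _ _ S).trans ?_))
      (ih hp.2.2.1 (fun x => emb (some (.inl x))) ex fun l => hP (some (.inl l)))
    rw [hf]
    rfl
  | @ite_false i j f p q S S' t hf h ih =>
    refine ReachIn.step (step_eq_some (hP (none : Option _))
      ((stepAux_test M m i j hp.1 hp.2.1 f _ _ S).trans ?_))
      (ih hp.2.2.2 (fun x => emb (some (.inr x))) ex fun l => hP (some (.inr l)))
    rw [hf]
    rfl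
  | @loop_true i j f p S S' S'' t t' hf h h' ih ih' =>
    refine ReachIn.step (step_eq_some (hP (none : Option _))
      ((stepAux_test M m i j hp.1 hp.2.1 f _ _ S).trans ?_))
      ((ih hp.2.2 (fun x => emb (some x)) (emb (none : Option _))
      fun l => hP (some l)).trans (ih' hp emb ex hP))
    rw [hf]
    rfl
  | @loop_false i j f p S hf =>
    refine ReachIn.single (step_eq_some (hP (none : Option _))
      ((stepAux_test M m i j hp.1 hp.2.1 f _ _ S).trans ?_))
    rw [hf]
    rfl
  | @call i j S g t hij ho =>
    obtain ⟨o, u, ⟨⟨⟨n, h₂⟩, hn⟩⟩, rfl, rfl⟩ := ho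
    have h₁ := reachIn_transfer M m inp P (emb (none : Option _)) (emb (some (some M.main))) i hp.1
      (hP (none : Option _)) (S i) S rfl []
    rw [initList_eq] at h₂
    have h₂ := (reachIn_lift M m P (fun x => emb (some (some x))) (emb (some (none : Option _)))
      (fun l => hP (some (some l))) (regs m (update S i [])) _ _ _ h₂)
    have h₃ : ReachIn (TM2.step P) (liftCfg M m (fun x => emb (some (some x)))
        (emb (some (none : Option _))) (regs m (update S i [])) (haltList M [o]))
        (cfg M m ex (update (update S i []) j (outp o :: S j))) 1 := by
      refine ReachIn.single (step_eq_some (hP (some (none : Option _))) ?_)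
      simp only [haltList_eq, code, stepAux, stk,
        update_self, List.head?, Option.map, List.tail, update_stk_machine, update_idem]
      rw [stepAux_pushBuffer _ _ _ (by simpa using hp.2) (by simp), stepAux_jump]
      have e : pushAll (update S i []) [j] [outp o] = update (update S i []) j (outp o :: S j) := by
        funext r
        by_cases h : r = j
        · subst h; simp [pushAll, hij.symm]
        · simp [pushAll, h]
      rw [e, update_eq_self_iff.2 rfl]
      rfl
    have e₁ : cfg M m (emb (entry M (.call i j))) S = ⟨some (emb (none : Option _)),
        ((none, none), M.initialState),
        stk M m (regs m S) (update (fun _ => []) M.k₀ []) []⟩ := by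
      rw [update_eq_self_iff.2 rfl]
      rfl
    rw [List.append_nil] at h₁
    rw [e₁]
    refine (h₁.trans (h₂.trans h₃)).mono ?_
    have : n ≤ u := hn
    omega
  | mono h ht ih => exact (ih hp emb ex hP).mono ht

/-- The program, followed by moving the top of register `1` to the output stack. -/
def main (p : Prog G) (outBit : G → Bool) : Option (Label M p) → Code G M m (Option (Label M p))
  | some l => code M m inp outp p some none l
  | none => .pop (reg M m 1) (fun v x => ((x, none), v.2))
      (.push (.inr (.inr ())) (fun v => outBit (v.1.1.getD default))
        (.load (fun v => ((none, none), v.2)) .halt))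

variable [Fintype G]

/-- The Turing machine of a program. -/
noncomputable def machine (p : Prog G) (outBit : G → Bool) : FinTM2 :=
  letI := M.kFin
  letI := M.σFin
  { K := Stacks M m
    k₀ := reg M m 0
    k₁ := .inr (.inr ())
    Γ := Alph G M m
    Λ := Option (Label M p)
    main := some (entry M p)
    σ := State G M
    initialState := ((none, none), M.initialState)
    Γk₀Fin := inferInstanceAs (Fintype G)
    m := main M m inp outp p outBit }

/-- A problem that is decided by a program in polynomial time is in PTIME. -/
theorem inPTIME_of_runs {α : Type} (enc : α → List G) (A : Set α) (p : Prog G) (outBit : G → Bool)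
    (q : Polynomial ℕ)
    (h : ∀ x, ∃ g, (outBit g = true ↔ x ∈ A) ∧ p.Runs (oracle M inp outp)
      (update (fun _ => []) 0 (enc x)) (update (fun _ => []) 1 [g]) (q.eval (enc x).length)) :
    InPTIME enc A := by
  classical
  obtain ⟨m', hm'⟩ := p.exists_below
  have hm := hm'.mono (Nat.le_add_right m' 2)
  obtain ⟨m, rfl⟩ : ∃ m, m = m' + 2 := ⟨_, rfl⟩
  have : NeZero (m' + 2) := ⟨by omega⟩
  refine ⟨⟨⟨machine M (m' + 2) inp outp p outBit, Equiv.refl G, Equiv.refl Bool⟩, q + 1,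
    fun x => Classical.choice ?_⟩⟩
  obtain ⟨g, hg, hr⟩ := h x
  have h₁ := reachIn_code M (m' + 2) inp outp (main M (m' + 2) inp outp p outBit) hr hm some none
    fun _ => rfl
  have h₂ := h₁.trans (ReachIn.single (step_eq_some (l := none) rfl rfl))
  obtain ⟨n, hn, e⟩ := h₂
  refine ⟨⟨⟨n, ?_⟩, by simpa using hn⟩⟩
  have z : stk M (m' + 2) (fun _ => ([] : List G)) (fun _ => []) [] = fun _ => [] := by
    funext k
    rcases k with k | k | k <;> rfl
  have z' : regs (m' + 2) (fun _ => ([] : List G)) = fun _ => [] := rfl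
  have e₁ : initList (machine M (m' + 2) inp outp p outBit) (enc x) =
      cfg M (m' + 2) (some (entry M p)) (update (fun _ => []) 0 (enc x)) := by
    refine (initList_eq _ _).trans ?_
    unfold cfg
    rw [← update_regs _ _ (by omega), ← update_stk_reg, z', z]
    rfl
  have e₂ : haltList (machine M (m' + 2) inp outp p outBit) [decide (x ∈ A)] =
      stepAux (main M (m' + 2) inp outp p outBit none) ((none, none), M.initialState)
        (stk M (m' + 2) (regs (m' + 2) (update (fun _ => []) 1 [g])) (fun _ => []) []) := by
    refine (haltList_eq _ _).trans ?_
    have h0 : (regs (m' + 2) (update (fun _ => []) 1 [g])) (idx (m' + 2) 1) = [g] := by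
      rw [regs_apply _ _ (by omega), update_self]
    have h1 : outBit g = decide (x ∈ A) := by
      rw [Bool.eq_iff_iff, hg, decide_eq_true_iff]
    simp only [main, stepAux, reg, stk, h0, update_stk_reg, update_stk_out, List.head?, List.tail,
      Option.getD, h1]
    rw [update_regs _ _ (by omega), update_idem, update_eq_self_iff.2 rfl, z',
      ← update_stk_out _ _ [], z]
    rfl
  have e₃ : (flip bind (machine M (m' + 2) inp outp p outBit).step)^[n]
      (some (initList (machine M (m' + 2) inp outp p outBit) (enc x))) =
      some (haltList (machine M (m' + 2) inp outp p outBit) [decide (x ∈ A)]) := by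
    rw [e₁, e₂]
    exact e
  convert e₃ using 2
  · exact congrArg some (congrArg (initList (machine M (m' + 2) inp outp p outBit))
      (List.map_id _))
  · rfl

end Compile

/-! ### Basic programs -/

namespace Prog

variable {G : Type} {O : List G → G → ℕ → Prop}

theorem Runs.of_eq {p : Prog G} {S S' S'' : Regs G} {t t' : ℕ} (h : p.Runs O S S' t)
    (hS : S' = S'') (ht : t ≤ t') : p.Runs O S S'' t' :=
  hS ▸ h.mono ht

/-- Do nothing. -/
def skip : Prog G := loop 0 0 (fun _ _ => false) (xfer 0 [])

theorem runs_skip (S : Regs G) : skip.Runs O S S 1 := Runs.loop_false rfl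

/-- Pop symbols from register `i` as long as they satisfy `f`, and push each of them on the
registers of the list. -/
def drain (f : G → Bool) (i : ℕ) (js : List ℕ) : Prog G :=
  loop i i (fun x _ => x.any f) (xfer i js)

theorem runs_drain {f : G → Bool} {i : ℕ} {js : List ℕ} (hi : i ∉ js) (hjs : js.Nodup)
    {S : Regs G} (x y : List G) (hS : S i = x ++ y) (hx : ∀ g ∈ x, f g = true)
    (hy : y.head?.any f = false) :
    (drain f i js).Runs O S (pushAll (update S i y) js x.reverse) (2 * x.length + 1) := by
  induction x generalizing S with
  | nil =>
    rw [List.nil_append] at hS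
    refine (Runs.loop_false (by simp [hS, hy])).of_eq ?_ le_rfl
    funext r
    by_cases h : r = i
    · subst h; simp [pushAll, hi, hS]
    · simp [pushAll, h]
  | cons g x ih =>
    refine (Runs.loop_true (by simp [hS, hx g]) (Runs.xfer hS hi hjs)
      (ih (S := pushAll (update S i (x ++ y)) js [g]) (by simp [pushAll, hi])
        fun g hg => hx g (by simp [hg]))).of_eq ?_ (by simp; omega)
    funext r
    by_cases h : r = i
    · subst h; simp [pushAll, hi]
    · by_cases h' : r ∈ js <;> simp [pushAll, h, h']

/-- Empty a register. -/
def clear (i : ℕ) : Prog G := drain (fun _ => true) i []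

theorem runs_clear (i : ℕ) (S : Regs G) :
    (clear i).Runs O S (update S i []) (2 * (S i).length + 1) := by
  refine (runs_drain (by simp) (by simp) (S i) [] (by simp) (by simp) rfl).of_eq ?_ le_rfl
  funext r
  simp [pushAll]

/-- Move the content of register `i` to register `j`, reversing it. -/
def move (i j : ℕ) : Prog G := drain (fun _ => true) i [j]

theorem runs_move {i j : ℕ} (hij : i ≠ j) (S : Regs G) :
    (move i j).Runs O S (update (update S i []) j ((S i).reverse ++ S j))
      (2 * (S i).length + 1) := by
  refine (runs_drain (by simpa using hij) (by simp) (S i) [] (by simp) (by simp) rfl).of_eq ?_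
    le_rfl
  funext r
  by_cases h : r = j
  · subst h; simp [pushAll, hij.symm]
  · simp [pushAll, h]

/-- Copy the content of register `i` to the empty register `j`, by way of the empty register
`k`. -/
def copy (i j k : ℕ) : Prog G := seq (move i k) (drain (fun _ => true) k [i, j])

theorem runs_copy {i j k : ℕ} (hij : i ≠ j) (hik : i ≠ k) (hjk : j ≠ k) (S : Regs G)
    (hk : S k = []) (hj : S j = []) :
    (copy i j k).Runs O S (update S j (S i)) (4 * (S i).length + 2) := by
  refine (Runs.seq (runs_move hik S) (runs_drain (x := (S i).reverse) (y := [])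
    (by simp [hik.symm, hjk.symm]) (by simp [hij]) (by simp [hk]) (by simp) rfl)).of_eq ?_
    (by simp; omega)
  funext r
  simp only [pushAll, update_apply, List.mem_cons, List.not_mem_nil, or_false]
  grind

/-- Pop the top symbol of a register. -/
theorem runs_pop {i : ℕ} {S : Regs G} {g : G} {s : List G} (h : S i = g :: s) :
    (xfer i []).Runs O S (update S i s) 1 :=
  (Runs.xfer h (by simp) (by simp)).of_eq (by funext r; simp [pushAll]) le_rfl

end Prog

/-! ### Encodings of facts -/

section Encoding

variable {S : Schema} {D N : Type} (encD : D → List Bool) (encN : N → List Bool)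

instance : Inhabited (Symb S) := ⟨.sep⟩

noncomputable instance : Fintype (Symb S) :=
  letI := S.finiteRel
  letI := Classical.decEq (Symb S)
  Fintype.ofSurjective (fun x : S.Rel ⊕ (Bool ⊕ Unit) =>
    match x with
    | .inl P => Symb.rel P
    | .inr (.inl b) => .bit b
    | .inr (.inr _) => .sep) fun
      | .rel P => ⟨.inl P, rfl⟩
      | .bit b => ⟨.inr (.inl b), rfl⟩
      | .sep => ⟨.inr (.inr ()), rfl⟩

def Symb.isRel : Symb S → Bool
  | .rel _ => true
  | _ => false

def Symb.isBit : Symb S → Bool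
  | .bit _ => true
  | _ => false

def Symb.isTrue : Symb S → Bool
  | .bit b => b
  | _ => false

/-- The representation of a fact without its relation symbol. -/
def encodeArgs (a : Fact S D N) : List (Symb S) :=
  (List.finRange (S.arity a.rel)).flatMap fun i =>
    (encodeVal encD encN (S.kind a.rel i) (a.args i)).map Symb.bit ++ [Symb.sep]

theorem encodeFact_eq (a : Fact S D N) :
    encodeFact encD encN a = Symb.rel a.rel :: encodeArgs encD encN a := rfl

theorem isRel_of_mem_encodeArgs {a : Fact S D N} {g : Symb S} (h : g ∈ encodeArgs encD encN a) :
    g.isRel = false := by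
  simp only [encodeArgs, List.mem_flatMap, List.mem_append, List.mem_map, List.mem_singleton] at h
  obtain ⟨i, -, ⟨b, -, rfl⟩ | rfl⟩ := h <;> rfl

theorem encodeFacts_cons (a : Fact S D N) (l : List (Fact S D N)) :
    encodeFacts encD encN (a :: l) = encodeFact encD encN a ++ encodeFacts encD encN l := rfl

theorem length_encodeFact_le {a : Fact S D N} {l : List (Fact S D N)} (h : a ∈ l) :
    (encodeFact encD encN a).length ≤ (encodeFacts encD encN l).length := by
  induction l with
  | nil => simp at h
  | cons b l ih =>
    rw [encodeFacts_cons, List.length_append]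
    rcases List.mem_cons.1 h with rfl | h
    · omega
    · have := ih h; omega

theorem length_le_length_encodeFacts (l : List (Fact S D N)) :
    l.length ≤ (encodeFacts encD encN l).length := by
  induction l with
  | nil => simp
  | cons a l ih =>
    rw [encodeFacts_cons, List.length_append, encodeFact_eq]
    simp only [List.length_cons]
    omega

theorem head_encodeFacts (l : List (Fact S D N)) :
    ((encodeFacts encD encN l).head?.any fun g => !g.isRel) = false := by
  cases l with
  | nil => rfl
  | cons a l => rfl

end Encoding

/-! ### Predicates decided by programs in polynomial time -/

section PolyDec

variable {S : Schema} {D N : Type} (encD : D → List Bool) (encN : N → List Bool)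
  (O : List (Symb S) → Symb S → ℕ → Prop)

/-- Register `0` contains the list of facts `l`, the odd registers contain the facts of the list
`ws`, and all registers beyond are empty. -/
def Env (l ws : List (Fact S D N)) (R : Regs (Symb S)) : Prop :=
  R 0 = encodeFacts encD encN l ∧
  (∀ i (h : i < ws.length), R (2 * i + 1) = encodeFact encD encN ws[i]) ∧
  ∀ r, 2 * ws.length < r → R r = []

/-- The predicate `P`, about a list `l` of facts and `k` facts out of it, is decided on the domain
`dom` by a program in time polynomial in the size of `l`. -/
def PolyDec (k : ℕ) (dom P : List (Fact S D N) → List (Fact S D N) → Prop) : Prop :=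
  ∃ (p : Prog (Symb S)) (q : Polynomial ℕ), ∀ l ws, ws.length = k → (∀ w ∈ ws, w ∈ l) →
    dom l ws → ∀ R, Env encD encN l ws R → ∃ b : Bool, (b = true ↔ P l ws) ∧
      p.Runs O R (update R (2 * k + 1) [.bit b]) (q.eval (encodeFacts encD encN l).length)

namespace PolyDec

variable {encD encN O} {k : ℕ} {dom P Q : List (Fact S D N) → List (Fact S D N) → Prop}

theorem congr {dom' : List (Fact S D N) → List (Fact S D N) → Prop}
    (h : PolyDec encD encN O k dom P)
    (hd : ∀ l ws, ws.length = k → (∀ w ∈ ws, w ∈ l) → dom' l ws → dom l ws)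
    (hP : ∀ l ws, ws.length = k → (∀ w ∈ ws, w ∈ l) → dom' l ws → (P l ws ↔ Q l ws)) :
    PolyDec encD encN O k dom' Q := by
  obtain ⟨p, q, h⟩ := h
  refine ⟨p, q, fun l ws hk hl hdom R hR => ?_⟩
  obtain ⟨b, hb, hr⟩ := h l ws hk hl (hd l ws hk hl hdom) R hR
  exact ⟨b, hb.trans (hP l ws hk hl hdom), hr⟩

theorem const (c : Prop) : PolyDec encD encN O k dom fun _ _ => c := by
  classical
  refine ⟨.push (2 * k + 1) (.bit (decide c)), 1, fun l ws hk hl hdom R hR =>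
    ⟨decide c, by simp, (Prog.Runs.push _ _ _).of_eq ?_ (by simp)⟩⟩
  rw [hR.2.2 (2 * k + 1) (by omega)]

theorem not (h : PolyDec encD encN O k dom P) : PolyDec encD encN O k dom fun l ws => ¬ P l ws := by
  obtain ⟨p, q, h⟩ := h
  refine ⟨.seq p (.ite (2 * k + 1) (2 * k + 1) (fun x _ => x.any Symb.isTrue)
    (.seq (.xfer (2 * k + 1) []) (.push (2 * k + 1) (.bit false)))
    (.seq (.xfer (2 * k + 1) []) (.push (2 * k + 1) (.bit true)))), q + 3,
    fun l ws hk hl hdom R hR => ?_⟩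
  obtain ⟨b, hb, hr⟩ := h l ws hk hl hdom R hR
  have hpop : (Prog.xfer (2 * k + 1) []).Runs O (update R (2 * k + 1) [.bit b])
      (update R (2 * k + 1) []) 1 :=
    (Prog.runs_pop (i := 2 * k + 1) (by rw [update_self])).of_eq (by simp) le_rfl
  refine ⟨!b, by simp [← hb], ?_⟩
  cases b
  · refine (Prog.Runs.seq hr (Prog.Runs.ite_false (by simp [Symb.isTrue])
      (Prog.Runs.seq hpop (Prog.Runs.push _ _ _)))).of_eq (by simp) (by simp)
  · refine (Prog.Runs.seq hr (Prog.Runs.ite_true (by simp [Symb.isTrue])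
      (Prog.Runs.seq hpop (Prog.Runs.push _ _ _)))).of_eq (by simp) (by simp)

theorem and (h : PolyDec encD encN O k dom P)
    (h' : PolyDec encD encN O k (fun l ws => dom l ws ∧ P l ws) Q) :
    PolyDec encD encN O k dom fun l ws => P l ws ∧ Q l ws := by
  obtain ⟨p, q, h⟩ := h
  obtain ⟨p', q', h'⟩ := h'
  refine ⟨.seq p (.ite (2 * k + 1) (2 * k + 1) (fun x _ => x.any Symb.isTrue)
    (.seq (.xfer (2 * k + 1) []) p') .skip), q + (q' + 2), fun l ws hk hl hdom R hR => ?_⟩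
  obtain ⟨b, hb, hr⟩ := h l ws hk hl hdom R hR
  cases b
  · refine ⟨false, by simpa using fun hP => absurd hP (by simpa using hb), ?_⟩
    exact (Prog.Runs.seq hr (Prog.Runs.ite_false (by simp [Symb.isTrue])
      (Prog.runs_skip _))).of_eq rfl (by simp)
  · have hP : P l ws := by simpa using hb
    have hpop : (Prog.xfer (2 * k + 1) []).Runs O (update R (2 * k + 1) [.bit true]) R 1 :=
      (Prog.runs_pop (i := 2 * k + 1) (by rw [update_self])).of_eq
        (by simpa using (hR.2.2 (2 * k + 1) (by omega)).symm) le_rfl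
    obtain ⟨b', hb', hr'⟩ := h' l ws hk hl ⟨hdom, hP⟩ R hR
    refine ⟨b', by simp [hb', hP], ?_⟩
    exact (Prog.Runs.seq hr (Prog.Runs.ite_true (by simp [Symb.isTrue])
      (Prog.Runs.seq hpop hr'))).of_eq rfl (by simp; omega)

theorem or (h : PolyDec encD encN O k dom P) (h' : PolyDec encD encN O k dom Q) :
    PolyDec encD encN O k dom fun l ws => P l ws ∨ Q l ws :=
  (h.not.and (h'.not.congr (fun _ _ _ _ h => h.1) fun _ _ _ _ _ => Iff.rfl)).not.congr
    (fun _ _ _ _ h => h) fun _ _ _ _ _ => by tauto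

theorem imp (h : PolyDec encD encN O k dom P)
    (h' : PolyDec encD encN O k (fun l ws => dom l ws ∧ P l ws) Q) :
    PolyDec encD encN O k dom fun l ws => P l ws → Q l ws :=
  (h.and h'.not).not.congr (fun _ _ _ _ h => h) fun _ _ _ _ _ => by tauto

theorem exists_mem_list {ι : Type} (L : List ι)
    {P : ι → List (Fact S D N) → List (Fact S D N) → Prop}
    (h : ∀ i ∈ L, PolyDec encD encN O k dom (P i)) :
    PolyDec encD encN O k dom fun l ws => ∃ i ∈ L, P i l ws := by
  induction L with
  | nil => exact (const False).congr (fun _ _ _ _ h => h) fun _ _ _ _ _ => by simp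
  | cons i L ih =>
    exact ((h i (by simp)).or (ih fun j hj => h j (by simp [hj]))).congr
      (fun _ _ _ _ h => h) fun _ _ _ _ _ => by simp

theorem exists_mem_finset {ι : Type} (L : Finset ι)
    {P : ι → List (Fact S D N) → List (Fact S D N) → Prop}
    (h : ∀ i ∈ L, PolyDec encD encN O k dom (P i)) :
    PolyDec encD encN O k dom fun l ws => ∃ i ∈ L, P i l ws :=
  (exists_mem_list L.toList fun i hi => h i (by simpa using hi)).congr
    (fun _ _ _ _ h => h) fun _ _ _ _ _ => by simp

theorem forall_mem_finset {ι : Type} (L : Finset ι)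
    {P : ι → List (Fact S D N) → List (Fact S D N) → Prop}
    (h : ∀ i ∈ L, PolyDec encD encN O k dom (P i)) :
    PolyDec encD encN O k dom fun l ws => ∀ i ∈ L, P i l ws :=
  (exists_mem_finset L fun i hi => (h i hi).not).not.congr
    (fun _ _ _ _ h => h) fun _ _ _ _ _ => by simp

theorem exists_fintype {ι : Type} [Fintype ι]
    {P : ι → List (Fact S D N) → List (Fact S D N) → Prop}
    (h : ∀ i, PolyDec encD encN O k dom (P i)) :
    PolyDec encD encN O k dom fun l ws => ∃ i, P i l ws :=
  (exists_mem_finset Finset.univ fun i _ => h i).congr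
    (fun _ _ _ _ h => h) fun _ _ _ _ _ => by simp

theorem forall_fintype {ι : Type} [Fintype ι]
    {P : ι → List (Fact S D N) → List (Fact S D N) → Prop}
    (h : ∀ i, PolyDec encD encN O k dom (P i)) :
    PolyDec encD encN O k dom fun l ws => ∀ i, P i l ws :=
  (forall_mem_finset Finset.univ fun i _ => h i).congr
    (fun _ _ _ _ h => h) fun _ _ _ _ _ => by simp

/-- Move the first fact of the list in register `i` to register `j`, by way of the empty
register `t`. -/
def takeFact (i j t : ℕ) : Prog (Symb S) :=
  .seq (.xfer i [t]) (.seq (.drain (fun g => !g.isRel) i [t]) (.move t j))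

theorem runs_takeFact {i j t : ℕ} (hij : i ≠ j) (hit : i ≠ t) (hjt : j ≠ t) {R : Regs (Symb S)}
    {a : Fact S D N} {l : List (Fact S D N)} (hi : R i = encodeFacts encD encN (a :: l))
    (hj : R j = []) (ht : R t = []) :
    (takeFact i j t).Runs O R (update (update R i (encodeFacts encD encN l)) j
      (encodeFact encD encN a)) (4 * (encodeFact encD encN a).length + 3) := by
  rw [encodeFacts_cons, encodeFact_eq, List.cons_append] at hi
  refine (Prog.Runs.seq (Prog.Runs.xfer hi (by simpa using hit) (by simp))
    (Prog.Runs.seq (Prog.runs_drain (x := encodeArgs encD encN a) (y := encodeFacts encD encN l)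
      (by simpa using hit) (by simp) (by simp [pushAll, hit]) ?_
      (head_encodeFacts encD encN l)) (Prog.runs_move hjt.symm _))).of_eq ?_ ?_
  · intro g hg
    simp [isRel_of_mem_encodeArgs encD encN hg]
  · funext r
    simp only [encodeFact_eq]
    by_cases h1 : r = j
    · subst h1
      simp [pushAll, hjt, hij.symm, ht, hj, hit.symm]
    · by_cases h2 : r = i
      · subst h2
        simp [pushAll, hit, hij]
      · by_cases h3 : r = t
        · subst h3; simp [h1, h2, ht]
        · simp [pushAll, h1, h2, h3]
  · simp [pushAll, ht, hit.symm, encodeFact_eq]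
    omega

end PolyDec

end PolyDec

section PolyDec

variable {S : Schema} {D N : Type} {encD : D → List Bool} {encN : N → List Bool}
  {O : List (Symb S) → Symb S → ℕ → Prop}

namespace PolyDec

variable {k : ℕ} {dom P Q : List (Fact S D N) → List (Fact S D N) → Prop}

/-- Search the facts in register `2 * k + 2` for one that passes the test `p`. -/
def search (k : ℕ) (p : Prog (Symb S)) : Prog (Symb S) :=
  .loop (2 * k + 2) (2 * k + 2) (fun x _ => x.isSome)
    (.seq (takeFact (2 * k + 2) (2 * k + 1) (2 * k + 3))
      (.seq p (.seq (.clear (2 * k + 1))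
        (.ite (2 * k + 3) (2 * k + 3) (fun x _ => x.any Symb.isTrue)
          (.clear (2 * k + 2)) (.xfer (2 * k + 3) [])))))

theorem runs_search {p : Prog (Symb S)} {B : ℕ} {l ws : List (Fact S D N)} (hk : ws.length = k)
    (hp : ∀ w ∈ l, ∀ R, Env encD encN l (ws ++ [w]) R → ∃ b : Bool, (b = true ↔ P l (ws ++ [w])) ∧
      p.Runs O R (update R (2 * (k + 1) + 1) [.bit b]) B)
    (l' : List (Fact S D N)) (hl' : ∀ w ∈ l', w ∈ l)
    (hn : (encodeFacts encD encN l').length ≤ (encodeFacts encD encN l).length)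
    (R : Regs (Symb S)) (hR : Env encD encN l ws (update R (2 * k + 2) []))
    (hR' : R (2 * k + 2) = encodeFacts encD encN l') :
    ∃ b : Bool, (b = true ↔ ∃ w ∈ l', P l (ws ++ [w])) ∧
      (search k p).Runs O R (update (update R (2 * k + 2) []) (2 * k + 3)
        (if b then [.bit true] else []))
        (l'.length * (B + 8 * (encodeFacts encD encN l).length + 8) + 1) := by
  obtain ⟨hR0, hR1, hR2⟩ := hR
  rw [hk] at hR2
  have z1 : R (2 * k + 1) = [] := by simpa using hR2 (2 * k + 1) (by omega)
  have z3 : R (2 * k + 3) = [] := by simpa using hR2 (2 * k + 3) (by omega)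
  induction l' generalizing R with
  | nil =>
    refine ⟨false, by simp, (Prog.Runs.loop_false (by simp [hR', encodeFacts])).of_eq ?_
      (by simp)⟩
    have z2 : R (2 * k + 2) = [] := hR'
    funext r
    simp only [update_apply]
    grind
  | cons a l' ih =>
    have ha : a ∈ l := hl' a (by simp)
    have hla := length_encodeFact_le encD encN ha
    have hl'' : (encodeFacts encD encN l').length ≤ (encodeFacts encD encN l).length := by
      rw [encodeFacts_cons, List.length_append] at hn
      omega
    have h₁ := runs_takeFact (O := O) (i := 2 * k + 2) (j := 2 * k + 1) (t := 2 * k + 3) (by omega)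
      (by omega) (by omega) hR' z1 z3
    obtain ⟨b, hb, h₂⟩ := hp a ha (update (update R (2 * k + 2) (encodeFacts encD encN l'))
      (2 * k + 1) (encodeFact encD encN a)) (by
        refine ⟨?_, fun i hi => ?_, fun r hr => ?_⟩
        · simpa using hR0
        · rw [List.length_append, List.length_singleton] at hi
          by_cases hik : i < ws.length
          · rw [List.getElem_append_left hik]
            have := hR1 i hik
            simp only [update_apply] at this ⊢
            grind
          · obtain rfl : i = k := by omega
            simp [← hk]
        · simp only [List.length_append, List.length_singleton, hk] at hr
          have := hR2 r (by omega)
          simp only [update_apply] at this ⊢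
          grind)
    have h₃ := Prog.runs_clear (O := O) (2 * k + 1) (update (update (update R (2 * k + 2)
      (encodeFacts encD encN l')) (2 * k + 1) (encodeFact encD encN a)) (2 * (k + 1) + 1)
      [.bit b])
    have e₃ : update (update (update (update R (2 * k + 2)
      (encodeFacts encD encN l')) (2 * k + 1) (encodeFact encD encN a)) (2 * (k + 1) + 1)
      [.bit b]) (2 * k + 1) [] = update (update R (2 * k + 2) (encodeFacts encD encN l'))
        (2 * k + 3) [.bit b] := by
      funext r
      simp only [update_apply]
      grind
    rw [e₃] at h₃
    have hlen : (update (update (update R (2 * k + 2)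
      (encodeFacts encD encN l')) (2 * k + 1) (encodeFact encD encN a)) (2 * (k + 1) + 1)
      [.bit b] (2 * k + 1)).length = (encodeFact encD encN a).length := by
      simp
    rw [hlen] at h₃
    have hcond : ((R (2 * k + 2)).head?.isSome) = true := by
      rw [hR', encodeFacts_cons, encodeFact_eq]; rfl
    cases b with
    | true =>
      refine ⟨true, by simp [hb.1 rfl], ?_⟩
      refine (Prog.Runs.loop_true hcond (h₁.seq (h₂.seq (h₃.seq (Prog.Runs.ite_true
        (by simp [Symb.isTrue]) (Prog.runs_clear _ _))))) (Prog.Runs.loop_false ?_)).of_eq ?_ ?_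
      · simp
      · funext r
        simp only [update_apply]
        grind
      · have e : (update (update R (2 * k + 2) (encodeFacts encD encN l')) (2 * k + 3)
            [.bit true] (2 * k + 2)) = encodeFacts encD encN l' := by simp
        rw [e, List.length_cons, Nat.add_mul, Nat.one_mul]
        omega
    | false =>
      have hb' : ¬ P l (ws ++ [a]) := by simpa using hb
      have e₄ : update (update (update R (2 * k + 2) (encodeFacts encD encN l'))
          (2 * k + 3) [Symb.bit false]) (2 * k + 3) [] =
          update R (2 * k + 2) (encodeFacts encD encN l') := by
        funext r
        simp only [update_apply]
        grind
      have h₄ : (Prog.xfer (2 * k + 3) []).Runs O (update (update R (2 * k + 2)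
          (encodeFacts encD encN l')) (2 * k + 3) [Symb.bit false])
          (update R (2 * k + 2) (encodeFacts encD encN l')) 1 :=
        (Prog.runs_pop (i := 2 * k + 3) (by rw [update_self])).of_eq e₄ le_rfl
      obtain ⟨b, hb, h₅⟩ := ih (fun w hw => hl' w (by simp [hw])) hl''
        (update R (2 * k + 2) (encodeFacts encD encN l')) (by simp)
        (by simpa using hR0) (by simpa using hR1) (by simpa using hR2) (by simpa using z1)
        (by simpa using z3)
      refine ⟨b, by simp [hb, hb'], ?_⟩
      refine (Prog.Runs.loop_true hcond (h₁.seq (h₂.seq (h₃.seq (Prog.Runs.ite_false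
        (by simp [Symb.isTrue]) h₄)))) h₅).of_eq (by simp) ?_
      rw [List.length_cons, Nat.add_mul, Nat.one_mul]
      omega

theorem exists_mem (h : PolyDec encD encN O (k + 1) (fun _ _ => True) P) :
    PolyDec encD encN O k dom fun l ws => ∃ w ∈ l, P l (ws ++ [w]) := by
  obtain ⟨p, q, h⟩ := h
  refine ⟨.seq (.copy 0 (2 * k + 2) (2 * k + 3)) (.seq (search k p)
    (.ite (2 * k + 3) (2 * k + 3) (fun x _ => x.isSome)
      (.seq (.xfer (2 * k + 3) []) (.push (2 * k + 1) (.bit true)))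
      (.push (2 * k + 1) (.bit false)))),
    .X * (q + 8 * .X + 8) + (4 * .X + 6), fun l ws hk hl _ R hR => ?_⟩
  have z1 : R (2 * k + 1) = [] := hR.2.2 _ (by omega)
  have z2 : R (2 * k + 2) = [] := hR.2.2 _ (by omega)
  have z3 : R (2 * k + 3) = [] := hR.2.2 _ (by omega)
  have h₁ := Prog.runs_copy (O := O) (i := 0) (j := 2 * k + 2) (k := 2 * k + 3) (by omega)
    (by omega) (by omega) R z3 z2
  rw [hR.1] at h₁
  obtain ⟨b, hb, h₂⟩ := runs_search (O := O) (p := p) hk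
    (fun w hw R hR => h l (ws ++ [w]) (by simp [hk])
      (fun v hv => (List.mem_append.1 hv).elim (hl v) (by simp; rintro rfl; exact hw))
      trivial R hR) l (fun _ h => h) le_rfl
    (update R (2 * k + 2) (encodeFacts encD encN l))
    (by rw [update_idem, ← z2, update_eq_self]; exact hR) (by simp)
  have hlen := Nat.mul_le_mul_right (q.eval (encodeFacts encD encN l).length +
    8 * (encodeFacts encD encN l).length + 8) (length_le_length_encodeFacts encD encN l)
  refine ⟨b, hb, ?_⟩
  rw [update_idem] at h₂
  cases b with
  | true =>
    refine (h₁.seq (h₂.seq (Prog.Runs.ite_true (by simp) ((Prog.runs_pop (g := .bit true) (s := [])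
      (by simp)).seq (Prog.Runs.push _ _ _))))).of_eq ?_ ?_
    · funext r
      simp only [update_apply]
      grind
    · simp
      omega
  | false =>
    refine (h₁.seq (h₂.seq (Prog.Runs.ite_false (by simp) (Prog.Runs.push _ _ _)))).of_eq ?_ ?_
    · funext r
      simp only [update_apply]
      grind
    · simp
      omega

theorem exists_list {j : ℕ} (h : PolyDec encD encN O (k + j) (fun _ _ => True) P) :
    PolyDec encD encN O k (fun _ _ => True) fun l ws =>
      ∃ vs : List (Fact S D N), vs.length = j ∧ (∀ v ∈ vs, v ∈ l) ∧ P l (ws ++ vs) := by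
  induction j generalizing k with
  | zero => exact h.congr (fun _ _ _ _ h => h) fun _ _ _ _ _ => by simp
  | succ j ih =>
    refine (exists_mem (ih (k := k + 1) (by rwa [Nat.add_right_comm]))).congr
      (fun _ _ _ _ h => h) fun l ws _ _ _ => ⟨?_, ?_⟩
    · rintro ⟨w, hw, vs, hvs, hl, hP⟩
      exact ⟨w :: vs, by simp [hvs], by simpa [hw] using hl, by simpa using hP⟩
    · rintro ⟨vs, hvs, hl, hP⟩
      cases vs with
      | nil => simp at hvs
      | cons w vs =>
        exact ⟨w, hl w (by simp), vs, by simpa using hvs, fun v hv => hl v (by simp [hv]),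
          by simpa using hP⟩

/-- The `i`-th fact has the relation symbol `P`. -/
theorem rel_eq {i : ℕ} (hi : i < k) (P : S.Rel) :
    PolyDec encD encN O k dom fun _ ws => ∃ w, ws[i]? = some w ∧ w.rel = P := by
  classical
  refine ⟨.ite (2 * i + 1) (2 * i + 1) (fun x _ => decide (x = some (Symb.rel P)))
    (.push (2 * k + 1) (.bit true)) (.push (2 * k + 1) (.bit false)), 2,
    fun l ws hk hl _ R hR => ?_⟩
  have z1 : R (2 * k + 1) = [] := hR.2.2 _ (by omega)
  have hw := hR.2.1 i (by omega)
  have hc : decide ((R (2 * i + 1)).head? = some (Symb.rel P)) = decide (ws[i].rel = P) := by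
    rw [hw, encodeFact_eq]
    simp
  by_cases h : ws[i].rel = P
  · refine ⟨true, ?_, (Prog.Runs.ite_true (by rw [hc]; simpa using h)
      (Prog.Runs.push _ _ _)).of_eq (by rw [z1]) (by simp)⟩
    simpa using ⟨_, List.getElem?_eq_getElem (by omega), h⟩
  · refine ⟨false, ?_, (Prog.Runs.ite_false (by rw [hc]; simpa using h)
      (Prog.Runs.push _ _ _)).of_eq (by rw [z1]) (by simp)⟩
    simp only [Bool.false_eq_true, false_iff]
    rintro ⟨w, hw, hw'⟩
    rw [List.getElem?_eq_getElem (by omega)] at hw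
    cases hw
    exact h hw'

end PolyDec

end PolyDec

/-! ### Values of terms as strings -/

section Strings

variable {S : Schema} {D N : Type} (encD : D → List Bool) (encN : N → List Bool)

/-- The representations of the arguments of a fact. -/
def argStrings (a : Fact S D N) : List (List Bool) :=
  (List.finRange (S.arity a.rel)).map fun i =>
    encodeVal encD encN (S.kind a.rel i) (a.args i)

/-- Strings, each followed by a separator. -/
def encodeStrings (S : Schema) (ss : List (List Bool)) : List (Symb S) :=
  ss.flatMap fun s => s.map Symb.bit ++ [Symb.sep]

theorem encodeArgs_eq (a : Fact S D N) :
    encodeArgs encD encN a = encodeStrings S (argStrings encD encN a) := by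
  simp [encodeArgs, encodeStrings, argStrings, List.flatMap_map]

theorem encodeStrings_cons (s : List Bool) (ss : List (List Bool)) :
    encodeStrings S (s :: ss) = s.map Symb.bit ++ Symb.sep :: encodeStrings S ss := by
  simp [encodeStrings]

theorem length_encodeStrings_tail_le (ss : List (List Bool)) :
    (encodeStrings S ss.tail).length ≤ (encodeStrings S ss).length := by
  cases ss with
  | nil => simp
  | cons s ss => rw [encodeStrings_cons]; simp; omega

theorem length_encodeStrings_drop_le (ss : List (List Bool)) (j : ℕ) :
    (encodeStrings S (ss.drop j)).length ≤ (encodeStrings S ss).length := by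
  induction j with
  | zero => simp
  | succ j ih =>
    rw [← List.tail_drop]
    exact (length_encodeStrings_tail_le _).trans ih

theorem length_headD_le (ss : List (List Bool)) :
    (ss.headD []).length ≤ (encodeStrings S ss).length := by
  cases ss with
  | nil => simp
  | cons s ss => rw [encodeStrings_cons]; simp

/-- A string given as a constant or as the representation of the `j`-th argument of the `i`-th
fact of a list. -/
inductive StrTerm : Type
  | const (s : List Bool)
  | arg (i j : ℕ)

/-- The value of a string term; it is empty if there is no such argument. -/
def StrTerm.eval (ws : List (Fact S D N)) : StrTerm → List Bool
  | .const s => s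
  | .arg i j => (ws[i]?.elim [] (argStrings encD encN)).getD j []

/-- The string term refers to the first `k` facts only. -/
def StrTerm.Below (k : ℕ) : StrTerm → Prop
  | .const _ => True
  | .arg i _ => i < k

variable {encD encN}

/-- The size of the constants of a string term. -/
def StrTerm.size : StrTerm → ℕ
  | .const s => s.length
  | .arg _ _ => 0

theorem StrTerm.length_eval_le {l ws : List (Fact S D N)} (hl : ∀ w ∈ ws, w ∈ l)
    (t : StrTerm) :
    (t.eval encD encN ws).length ≤ (encodeFacts encD encN l).length + t.size := by
  cases t with
  | const s => simp [StrTerm.eval, StrTerm.size]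
  | arg i j =>
    rw [StrTerm.eval, StrTerm.size]
    cases h : ws[i]? with
    | none => simp
    | some w =>
      have h₁ := length_encodeFact_le encD encN (hl w (List.mem_of_getElem? h))
      rw [encodeFact_eq, List.length_cons, encodeArgs_eq] at h₁
      have h₂ := length_encodeStrings_drop_le (S := S) (argStrings encD encN w) j
      have h₃ := length_headD_le (S := S) ((argStrings encD encN w).drop j)
      simp only [Option.elim]
      have e : (argStrings encD encN w).getD j [] = ((argStrings encD encN w).drop j).headD [] := by
        simp
      rw [e]
      omega

end Strings

/-! ### Programs on strings -/

namespace Prog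

variable {S : Schema} {O : List (Symb S) → Symb S → ℕ → Prop}

/-- Pop a symbol from a register, if it is nonempty. -/
def popIf (i : ℕ) : Prog (Symb S) := .ite i i (fun x _ => x.isSome) (.xfer i []) .skip

theorem runs_popIf (i : ℕ) (R : Regs (Symb S)) :
    (popIf i).Runs O R (update R i (R i).tail) 2 := by
  cases h : R i with
  | nil =>
    refine (Runs.ite_false (by simp [h]) (runs_skip _)).of_eq ?_ le_rfl
    rw [List.tail_nil, ← h, update_eq_self]
  | cons g s => exact Runs.ite_true (by simp [h]) (runs_pop h)

/-- Move a string from register `i` to register `j`, reversing it. -/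
theorem runs_drain_bit {i : ℕ} {js : List ℕ} (hi : i ∉ js) (hjs : js.Nodup) {R : Regs (Symb S)}
    {ss : List (List Bool)} (h : R i = encodeStrings S ss) :
    (drain Symb.isBit i js).Runs O R (pushAll
      (update R i ((encodeStrings S ss).drop (ss.headD []).length)) js
        ((ss.headD []).map Symb.bit).reverse)
      (2 * (encodeStrings S ss).length + 1) := by
  have hb : ∀ s : List Bool, ∀ g ∈ (s.map Symb.bit : List (Symb S)), g.isBit = true := by
    intro s g hg
    obtain ⟨b, -, rfl⟩ := List.mem_map.1 hg
    rfl
  cases ss with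
  | nil => exact (runs_drain hi hjs [] [] h (by simp) rfl).of_eq (by simp [encodeStrings]) (by simp)
  | cons s ss =>
    rw [encodeStrings_cons] at h
    refine (runs_drain hi hjs _ _ h (hb s) rfl).of_eq ?_ ?_
    · simp [encodeStrings_cons]
    · simp [encodeStrings_cons]

/-- Remove the first `j` strings from register `i`. -/
def dropStrings (i : ℕ) : ℕ → Prog (Symb S)
  | 0 => .skip
  | j + 1 => .seq (dropStrings i j) (.seq (.drain Symb.isBit i []) (popIf i))

theorem runs_dropStrings (i j : ℕ) {R : Regs (Symb S)} {ss : List (List Bool)}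
    (h : R i = encodeStrings S ss) :
    (dropStrings i j).Runs O R (update R i (encodeStrings S (ss.drop j)))
      (j * (2 * (encodeStrings S ss).length + 3) + 1) := by
  induction j with
  | zero =>
    refine (runs_skip _).of_eq ?_ (by simp)
    rw [List.drop_zero, ← h, update_eq_self]
  | succ j ih =>
    refine (ih.seq ((runs_drain_bit (by simp) (by simp) (ss := ss.drop j) (by simp)).seq
      (runs_popIf _ _))).of_eq ?_ ?_
    · have : ((encodeStrings S (ss.drop j)).drop ((ss.drop j).headD []).length).tail =
          encodeStrings S (ss.drop (j + 1)) := by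
        rw [← List.tail_drop]
        cases ss.drop j with
        | nil => simp [encodeStrings]
        | cons s ss => simp [encodeStrings_cons]
      rw [← this]
      funext r
      by_cases hr : r = i
      · subst hr; simp [pushAll]
      · simp [pushAll, hr]
    · have := length_encodeStrings_drop_le (S := S) ss j
      rw [Nat.add_mul, Nat.one_mul]
      omega

/-- Push a string on a register, its last symbol becoming the top one. -/
def pushString (i : ℕ) : List Bool → Prog (Symb S)
  | [] => .skip
  | b :: s => .seq (.push i (.bit b)) (pushString i s)

theorem runs_pushString (i : ℕ) (s : List Bool) (R : Regs (Symb S)) :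
    (pushString i s).Runs O R (update R i ((s.map Symb.bit).reverse ++ R i)) (s.length + 1) := by
  induction s generalizing R with
  | nil => exact (runs_skip _).of_eq (by simp) (by simp)
  | cons b s ih =>
    refine ((Runs.push _ _ _).seq (ih _)).of_eq (by simp) (by simp; omega)

/-- Push the value of a string term on register `i`, using the registers `j` and `k`. -/
def pushTerm (i j k : ℕ) : StrTerm → Prog (Symb S)
  | .const s => pushString i s
  | .arg w a => .seq (.copy (2 * w + 1) j k) (.seq (.xfer j []) (.seq (dropStrings j a)
      (.seq (.drain Symb.isBit j [i]) (.clear j))))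

/-- A bound on the time taken by `pushTerm`. -/
noncomputable def pushTermTime : StrTerm → Polynomial ℕ
  | .const s => Polynomial.C (s.length + 1)
  | .arg _ a => (Polynomial.C a + 4) * (2 * Polynomial.X + 3)

variable {D N : Type} {encD : D → List Bool} {encN : N → List Bool}

theorem runs_pushTerm {l ws : List (Fact S D N)} (hl : ∀ w ∈ ws, w ∈ l) {R : Regs (Symb S)}
    (hR : ∀ w (h : w < ws.length), R (2 * w + 1) = encodeFact encD encN ws[w]) {i j k : ℕ}
    (hij : i ≠ j) (hik : i ≠ k) (hjk : j ≠ k) (hj : 2 * ws.length < j) (hk : 2 * ws.length < k)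
    (zj : R j = []) (zk : R k = []) {t : StrTerm} (ht : t.Below ws.length) :
    (pushTerm i j k t).Runs O R
      (update R i (((t.eval encD encN ws).map Symb.bit).reverse ++ R i))
      ((pushTermTime t).eval (encodeFacts encD encN l).length) := by
  cases t with
  | const s => exact (runs_pushString i s R).of_eq rfl (by simp [pushTermTime])
  | arg w a =>
    have hw : w < ws.length := ht
    have hRw := hR w hw
    have hlen := length_encodeFact_le encD encN (hl _ (List.getElem_mem hw))
    have h₁ := runs_copy (O := O) (i := 2 * w + 1) (j := j) (k := k) (by omega) (by omega) hjk R
      zk zj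
    rw [hRw, encodeFact_eq] at h₁
    rw [encodeFact_eq, List.length_cons, encodeArgs_eq] at hlen
    rw [encodeArgs_eq] at h₁
    generalize hss : argStrings encD encN ws[w] = ss at h₁ hlen
    have h₂ := runs_pop (O := O) (i := j) (S := update R j (Symb.rel ws[w].rel ::
      encodeStrings S ss)) (update_self ..)
    rw [update_idem] at h₂
    have h₃ := runs_dropStrings (O := O) j a (R := update R j (encodeStrings S ss))
      (update_self ..)
    rw [update_idem] at h₃
    have h₄ := runs_drain_bit (O := O) (i := j) (js := [i]) (by simpa using hij.symm) (by simp)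
      (R := update R j (encodeStrings S (ss.drop a))) (update_self ..)
    rw [update_idem] at h₄
    have hlen' := length_encodeStrings_drop_le (S := S) ss a
    refine (h₁.seq (h₂.seq (h₃.seq (h₄.seq (runs_clear _ _))))).of_eq ?_ ?_
    · have e : StrTerm.eval encD encN ws (.arg w a) = (ss.drop a).headD [] := by
        simp [StrTerm.eval, List.getElem?_eq_getElem hw, hss]
      rw [e]
      funext r
      by_cases hr : r = j
      · subst hr
        simp [hij.symm, zj]
      · by_cases hr' : r = i
        · subst hr'; simp [pushAll, hr]
        · simp [pushAll, hr, hr']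
    · have e : ((pushAll (update R j ((encodeStrings S (ss.drop a)).drop
          ((ss.drop a).headD []).length)) [i]
          (((ss.drop a).headD []).map Symb.bit).reverse) j).length ≤
          (encodeStrings S (ss.drop a)).length := by
        simp [pushAll, hij.symm]
      have hm := Nat.mul_le_mul_left a (show 2 * (encodeStrings S ss).length + 3 ≤
        2 * (encodeFacts encD encN l).length + 3 by omega)
      simp only [pushTermTime, Polynomial.eval_mul, Polynomial.eval_add, Polynomial.eval_C,
        Polynomial.eval_X, Polynomial.eval_ofNat, List.length_cons, Nat.add_mul]
      omega

open Classical in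
/-- Remove equal symbols from two registers. -/
noncomputable def strip (i j : ℕ) : Prog (Symb S) :=
  .loop i j (fun x y => x.isSome && decide (x = y)) (.seq (.xfer i []) (.xfer j []))

theorem runs_strip {i j : ℕ} (hij : i ≠ j) (x y : List (Symb S)) (R : Regs (Symb S))
    (hi : R i = x) (hj : R j = y) :
    ∃ x' y', (x' = [] ∧ y' = [] ↔ x = y) ∧ x'.length ≤ x.length ∧ y'.length ≤ y.length ∧
      (strip i j).Runs O R (update (update R i x') j y') (3 * x.length + 1) := by
  induction x generalizing y R with
  | nil =>
    refine ⟨[], y, by simp [eq_comm], le_rfl, le_rfl,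
      (Runs.loop_false (by simp [hi])).of_eq ?_ (by simp)⟩
    rw [← hi, ← hj, update_eq_self, update_eq_self]
  | cons g x ih =>
    by_cases h : y.head? = some g
    · cases y with
      | nil => simp at h
      | cons g' y =>
        obtain rfl : g' = g := by simpa using h
        obtain ⟨x', y', h₁, h₂, h₃, h₄⟩ := ih y (update (update R i x) j y)
          (by simp [hij]) (by simp)
        refine ⟨x', y', by simp [h₁], by simp; omega, by simp; omega, ?_⟩
        refine (Runs.loop_true (by simp [hi, hj]) ((runs_pop hi).seq (runs_pop (s := y)
          (by simpa [hij.symm] using hj))) h₄).of_eq ?_ (by simp; omega)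
        funext r
        simp only [update_apply]
        grind
    · refine ⟨g :: x, y, ?_, le_rfl, le_rfl,
        (Runs.loop_false ?_).of_eq ?_ (by simp)⟩
      · simp only [reduceCtorEq, false_and, false_iff]
        rintro rfl
        simp at h
      · have h' : ¬ some g = y.head? := fun h' => h h'.symm
        simp [hi, hj, h']
      · rw [← hi, ← hj, update_eq_self, update_eq_self]

/-- Compare the contents of two registers, emptying them, and leave the result on the first. -/
noncomputable def compare (i j : ℕ) : Prog (Symb S) :=
  .seq (strip i j)
    (.ite i j (fun x y => x.isNone && y.isNone) (.push i (.bit true))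
      (.seq (.clear i) (.seq (.clear j) (.push i (.bit false)))))

theorem runs_compare {i j : ℕ} (hij : i ≠ j) (x y : List (Symb S)) (R : Regs (Symb S))
    (hi : R i = x) (hj : R j = y) :
    ∃ b : Bool, (b = true ↔ x = y) ∧ (compare i j).Runs O R
      (update (update R j []) i [.bit b]) (5 * x.length + 2 * y.length + 6) := by
  obtain ⟨x', y', h₁, h₂, h₃, h₄⟩ := runs_strip (O := O) hij x y R hi hj
  by_cases h : x = y
  · obtain ⟨rfl, rfl⟩ := h₁.2 h
    refine ⟨true, by simp [h], (h₄.seq (Runs.ite_true (by simp [hij])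
      (Runs.push _ _ _))).of_eq ?_ (by omega)⟩
    funext r
    simp only [update_apply]
    grind
  · refine ⟨false, by simp [h], (h₄.seq (Runs.ite_false ?_
      ((runs_clear _ _).seq ((runs_clear _ _).seq (Runs.push _ _ _))))).of_eq ?_ ?_⟩
    · rw [← h₁] at h
      simpa [hij] using h
    · funext r
      simp only [update_apply]
      grind
    · simp [hij, hij.symm]
      omega

end Prog

theorem eval_mono (q : Polynomial ℕ) : Monotone fun n : ℕ => q.eval n := by
  intro m n hmn
  simp only [Polynomial.eval_eq_sum, Polynomial.sum]
  exact Finset.sum_le_sum fun i _ => Nat.mul_le_mul_left _ (Nat.pow_le_pow_left hmn i)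

namespace PolyDec

variable {S : Schema} {D N : Type} {encD : D → List Bool} {encN : N → List Bool}
  {O : List (Symb S) → Symb S → ℕ → Prop} {k : ℕ}
  {dom : List (Fact S D N) → List (Fact S D N) → Prop}

theorem map_bit_injective : Injective (List.map (Symb.bit : Bool → Symb S)) :=
  List.map_injective_iff.2 fun _ _ h => by injection h

/-- Two string terms have the same value. -/
theorem str_eq {t t' : StrTerm} (ht : t.Below k) (ht' : t'.Below k) :
    PolyDec encD encN O k dom fun _ ws => t.eval encD encN ws = t'.eval encD encN ws := by
  refine ⟨.seq (.pushTerm (2 * k + 1) (2 * k + 3) (2 * k + 4) t)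
    (.seq (.pushTerm (2 * k + 2) (2 * k + 3) (2 * k + 4) t') (.compare (2 * k + 1) (2 * k + 2))),
    Prog.pushTermTime t + (Prog.pushTermTime t' +
      (5 * (.X + .C t.size) + 2 * (.X + .C t'.size) + 6)), fun l ws hk hl _ R hR => ?_⟩
  subst hk
  have z1 : R (2 * ws.length + 1) = [] := hR.2.2 _ (by omega)
  have z2 : R (2 * ws.length + 2) = [] := hR.2.2 _ (by omega)
  have z3 : R (2 * ws.length + 3) = [] := hR.2.2 _ (by omega)
  have z4 : R (2 * ws.length + 4) = [] := hR.2.2 _ (by omega)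
  have h₁ := Prog.runs_pushTerm (O := O) hl hR.2.1 (i := 2 * ws.length + 1)
    (j := 2 * ws.length + 3) (k := 2 * ws.length + 4) (by omega) (by omega) (by omega) (by omega)
    (by omega) z3 z4 ht
  rw [z1, List.append_nil] at h₁
  set x := ((t.eval encD encN ws).map (Symb.bit (S := S))).reverse with hx
  have h₂ := Prog.runs_pushTerm (O := O) hl (R := update R (2 * ws.length + 1) x)
    (fun w h => by rw [update_of_ne (by omega)]; exact hR.2.1 w h) (i := 2 * ws.length + 2)
    (j := 2 * ws.length + 3) (k := 2 * ws.length + 4) (by omega) (by omega) (by omega) (by omega)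
    (by omega) (by simpa using z3) (by simpa using z4) ht'
  rw [update_of_ne (by omega), z2, List.append_nil] at h₂
  set y := ((t'.eval encD encN ws).map (Symb.bit (S := S))).reverse with hy
  obtain ⟨b, hb, h₃⟩ := Prog.runs_compare (O := O) (i := 2 * ws.length + 1)
    (j := 2 * ws.length + 2) (by omega) x y (update (update R (2 * ws.length + 1) x)
      (2 * ws.length + 2) y) (by simp) (by simp)
  refine ⟨b, ?_, (h₁.seq (h₂.seq h₃)).of_eq ?_ ?_⟩
  · rw [hb, hx, hy, List.reverse_inj, map_bit_injective.eq_iff]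
  · funext r
    simp only [update_apply]
    grind
  · have hx' := t.length_eval_le (encD := encD) (encN := encN) hl
    have hy' := t'.length_eval_le (encD := encD) (encN := encN) hl
    have ex : x.length = (t.eval encD encN ws).length := by simp [hx]
    have ey : y.length = (t'.eval encD encN ws).length := by simp [hy]
    simp only [Polynomial.eval_mul, Polynomial.eval_add, Polynomial.eval_C, Polynomial.eval_X,
      Polynomial.eval_ofNat]
    omega

/-- A pair of strings as it is handed to the oracle. -/
def query (S : Schema) (x y : List Bool) : List (Symb S) :=
  (y.map Symb.bit).reverse ++ Symb.sep :: (x.map Symb.bit).reverse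

/-- The order of `N` on the values of two string terms which represent elements of `N`. -/
theorem str_le [LE N] (q : Polynomial ℕ)
    (hO : ∀ x y : N, ∃ b : Bool, ∃ t ≤ q.eval ((encN x).length + (encN y).length + 1),
      (b = true ↔ x ≤ y) ∧ O (query S (encN x) (encN y)) (.bit b) t)
    {P : List (Fact S D N) → List (Fact S D N) → Prop}
    {t t' : StrTerm} (ht : t.Below k) (ht' : t'.Below k)
    (h : ∀ l ws, ws.length = k → dom l ws → ∃ x y : N, t.eval encD encN ws = encN x ∧
      t'.eval encD encN ws = encN y ∧ (P l ws ↔ x ≤ y)) :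
    PolyDec encD encN O k dom P := by
  refine ⟨.seq (.pushTerm (2 * k + 2) (2 * k + 3) (2 * k + 4) t)
    (.seq (.push (2 * k + 2) .sep)
    (.seq (.pushTerm (2 * k + 2) (2 * k + 3) (2 * k + 4) t') (.call (2 * k + 2) (2 * k + 1)))),
    Prog.pushTermTime t + (1 + (Prog.pushTermTime t' +
      q.comp ((.X + .C t.size) + (.X + .C t'.size) + 1))), fun l ws hk hl hd R hR => ?_⟩
  subst hk
  obtain ⟨x, y, hx, hy, hP⟩ := h l ws rfl hd
  obtain ⟨b, u, hu, hb, hOu⟩ := hO x y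
  have z1 : R (2 * ws.length + 1) = [] := hR.2.2 _ (by omega)
  have z2 : R (2 * ws.length + 2) = [] := hR.2.2 _ (by omega)
  have z3 : R (2 * ws.length + 3) = [] := hR.2.2 _ (by omega)
  have z4 : R (2 * ws.length + 4) = [] := hR.2.2 _ (by omega)
  have h₁ := Prog.runs_pushTerm (O := O) hl hR.2.1 (i := 2 * ws.length + 2)
    (j := 2 * ws.length + 3) (k := 2 * ws.length + 4) (by omega) (by omega) (by omega) (by omega)
    (by omega) z3 z4 ht
  rw [z2, List.append_nil, hx] at h₁
  have h₂ := Prog.Runs.push (O := O) (2 * ws.length + 2) Symb.sep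
    (update R (2 * ws.length + 2) ((encN x).map (Symb.bit (S := S))).reverse)
  rw [update_idem, update_self] at h₂
  have h₃ := Prog.runs_pushTerm (O := O) hl (R := update R (2 * ws.length + 2)
      (Symb.sep :: ((encN x).map (Symb.bit (S := S))).reverse))
    (fun w h => by rw [update_of_ne (by omega)]; exact hR.2.1 w h) (i := 2 * ws.length + 2)
    (j := 2 * ws.length + 3) (k := 2 * ws.length + 4) (by omega) (by omega) (by omega) (by omega)
    (by omega) (by simpa using z3) (by simpa using z4) ht'
  rw [update_idem, update_self, hy] at h₃
  have h₄ := Prog.Runs.call (O := O) (i := 2 * ws.length + 2) (j := 2 * ws.length + 1)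
    (S := update R (2 * ws.length + 2) (query S (encN x) (encN y))) (by omega)
    (by rw [update_self]; exact hOu)
  refine ⟨b, hb.trans hP.symm, (h₁.seq (h₂.seq (h₃.seq h₄))).of_eq ?_ ?_⟩
  · funext r
    simp only [update_apply]
    grind
  · have hx' := t.length_eval_le (encD := encD) (encN := encN) hl
    have hy' := t'.length_eval_le (encD := encD) (encN := encN) hl
    rw [hx] at hx'
    rw [hy] at hy'
    have := hu.trans (eval_mono q (show (encN x).length + (encN y).length + 1 ≤
      ((encodeFacts encD encN l).length + t.size) + ((encodeFacts encD encN l).length + t'.size) + 1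
      by omega))
    simp only [Polynomial.eval_add, Polynomial.eval_C, Polynomial.eval_X, Polynomial.eval_comp,
      Polynomial.eval_one]
    simp only at this
    omega

end PolyDec

/-! ### Repairs -/

section Repairs

variable {S : Schema} {D N : Type} [LinearOrder N]

theorem Consistent.mono {F : Finset (DenialConstraint S D N)} {r s : Instance S D N}
    (hs : Consistent F s) (h : r ⊆ s) : Consistent F r :=
  fun c hc ρ hρ => hs c hc ρ ⟨fun a ha => h (hρ.1 a ha), hρ.2⟩

open Classical in
/-- The repairs of `r` are the maximal consistent subsets of `r`. -/
theorem isRepair_iff {F : Finset (DenialConstraint S D N)} {r r' : Instance S D N} :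
    IsRepair F r r' ↔
      r' ⊆ r ∧ Consistent F r' ∧ ∀ a ∈ r, a ∉ r' → ¬ Consistent F (insert a r') := by
  refine and_congr_right fun hr => and_congr_right fun _ => ⟨fun h a ha ha' hc => ?_,
    fun h s hs hd x hx => ⟨hx.1, fun hxs => h x hx.1 hx.2 (hs.mono ?_)⟩⟩
  · have := h _ hc fun x hx => ⟨hx.1, fun hx' => hx.2 (by
      simpa using Or.inr (by simpa using hx'))⟩
    exact (this (a := a) ⟨ha, ha'⟩).2 (by simp)
  · refine Finset.insert_subset hxs fun y hy => ?_
    by_contra hys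
    exact (hd (a := y) ⟨hr hy, hys⟩).2 hy

/-- A consistent subset of `r` extends to a repair. -/
theorem exists_isRepair_superset {F : Finset (DenialConstraint S D N)} {r W : Instance S D N}
    (hW : W ⊆ r) (hc : Consistent F W) : ∃ r', IsRepair F r r' ∧ W ⊆ r' := by
  classical
  obtain ⟨r', hWr', hr'⟩ := (r.powerset.filter (Consistent F)).exists_le_maximal
    (Finset.mem_filter.2 ⟨Finset.mem_powerset.2 hW, hc⟩)
  have hm := Finset.mem_filter.1 hr'.prop
  have hsub := Finset.mem_powerset.1 hm.1
  refine ⟨r', isRepair_iff.2 ⟨hsub, hm.2, fun a ha ha' hca => ha' ?_⟩, hWr'⟩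
  exact hr'.le_of_ge (Finset.mem_filter.2
    ⟨Finset.mem_powerset.2 (Finset.insert_subset ha hsub), hca⟩) (Finset.subset_insert a r')
    (Finset.mem_insert_self a r')

open Classical in
/-- The facts that occur in a sentence. -/
noncomputable def GroundSentence.facts : GroundSentence S D N → Finset (Fact S D N)
  | .fact a => {a}
  | .builtin _ => ∅
  | .not φ => φ.facts
  | .and φ ψ => φ.facts ∪ ψ.facts
  | .or φ ψ => φ.facts ∪ ψ.facts

theorem GroundSentence.holds_congr {r s : Instance S D N} (Φ : GroundSentence S D N)
    (h : ∀ a ∈ Φ.facts, a ∈ r ↔ a ∈ s) : Φ.Holds r ↔ Φ.Holds s := by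
  induction Φ with
  | fact a => exact h a (by simp [facts])
  | builtin b => rfl
  | not φ ih => exact not_congr (ih h)
  | and φ ψ ih ih' =>
    exact and_congr (ih fun a ha => h a (by simp [facts, ha]))
      (ih' fun a ha => h a (by simp [facts, ha]))
  | or φ ψ ih ih' =>
    exact or_congr (ih fun a ha => h a (by simp [facts, ha]))
      (ih' fun a ha => h a (by simp [facts, ha]))

open Classical in
theorem exists_small_conflict {F : Finset (DenialConstraint S D N)} {r : Instance S D N}
    {a : Fact S D N} (h : ¬ Consistent F (insert a r)) :
    ∃ E ⊆ r, E.card ≤ F.sup (fun c => c.atoms.length) ∧ ¬ Consistent F (insert a E) := by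
  simp only [Consistent, DenialConstraint.Holds, not_forall, not_not] at h
  obtain ⟨c, hc, ρ, hρ, hb⟩ := h
  refine ⟨((c.atoms.map fun b => b.subst ρ).toFinset.erase a), fun x hx => ?_, ?_, fun hE =>
    hE c hc ρ ⟨fun b hb => ?_, hb⟩⟩
  · simp only [Finset.mem_erase, List.mem_toFinset, List.mem_map] at hx
    obtain ⟨hxa, b, hb, rfl⟩ := hx
    exact (Finset.mem_insert.1 (hρ b hb)).resolve_left hxa
  · refine (Finset.card_le_card (Finset.erase_subset _ _)).trans
      ((List.toFinset_card_le _).trans ?_)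
    rw [List.length_map]
    exact Finset.le_sup (f := fun c : DenialConstraint S D N => c.atoms.length) hc
  · by_cases hba : b.subst ρ = a
    · simp [hba]
    · refine Finset.mem_insert_of_mem (Finset.mem_erase.2 ⟨hba, ?_⟩)
      simpa using ⟨b, hb, rfl⟩

open Classical in
/-- That `Φ` is not consistently true has certificates of bounded size. -/
theorem exists_bound_certificate (F : Finset (DenialConstraint S D N))
    (Φ : GroundSentence S D N) : ∃ K, ∀ r : Instance S D N, r ∉ consistentAnswers F Φ ↔
      ∃ ws : List (Fact S D N), ws.length < K ∧ (∀ w ∈ ws, w ∈ r) ∧ Consistent F ws.toFinset ∧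
        ¬ Φ.Holds ws.toFinset ∧
        ∀ a ∈ Φ.facts, a ∈ r → a ∉ ws → ¬ Consistent F (ws ++ [a]).toFinset := by
  have hins : ∀ (a : Fact S D N) (ws : List (Fact S D N)),
      (ws ++ [a]).toFinset = insert a ws.toFinset := by
    intro a ws
    ext x
    simp
  refine ⟨Φ.facts.card + Φ.facts.card * F.sup (fun c => c.atoms.length) + 1, fun r => ?_⟩
  constructor
  · intro h
    simp only [consistentAnswers, Set.mem_ofPred_eq, not_forall] at h
    obtain ⟨r', hr', hΦ⟩ := h
    obtain ⟨hsub, hc, hmax⟩ := isRepair_iff.1 hr'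
    have hE : ∀ a, ∃ E ⊆ r', E.card ≤ F.sup (fun c => c.atoms.length) ∧
        (a ∈ r → a ∉ r' → ¬ Consistent F (insert a E)) := by
      intro a
      by_cases ha : a ∈ r ∧ a ∉ r'
      · obtain ⟨E, h₁, h₂, h₃⟩ := exists_small_conflict (hmax a ha.1 ha.2)
        exact ⟨E, h₁, h₂, fun _ _ => h₃⟩
      · exact ⟨∅, by simp, by simp, fun h h' => absurd ⟨h, h'⟩ ha⟩
    choose E hE₁ hE₂ hE₃ using hE
    set W := Φ.facts.filter (· ∈ r') ∪ Φ.facts.biUnion E with hW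
    have hWr : W ⊆ r' := Finset.union_subset (fun x hx => (Finset.mem_filter.1 hx).2)
      (Finset.biUnion_subset.2 fun a _ => hE₁ a)
    have hWΦ : ∀ a ∈ Φ.facts, a ∈ W ↔ a ∈ r' := fun a ha =>
      ⟨fun h => hWr h, fun h => Finset.mem_union_left _ (Finset.mem_filter.2 ⟨ha, h⟩)⟩
    refine ⟨W.toList, ?_, ?_, ?_, ?_, ?_⟩
    · rw [Finset.length_toList, Nat.lt_succ_iff]
      exact (Finset.card_union_le _ _).trans (Nat.add_le_add (Finset.card_filter_le _ _)
        (Finset.card_biUnion_le_card_mul _ _ _ fun a _ => hE₂ a))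
    · intro w hw
      exact hsub (hWr (Finset.mem_toList.1 hw))
    · rw [Finset.toList_toFinset]
      exact hc.mono hWr
    · rwa [Finset.toList_toFinset, Φ.holds_congr hWΦ]
    · intro a ha har haW
      rw [hins, Finset.toList_toFinset]
      rw [Finset.mem_toList, hWΦ a ha] at haW
      refine fun hcon => hE₃ a har haW (hcon.mono (Finset.insert_subset_insert _ ?_))
      exact (Finset.subset_biUnion_of_mem E ha).trans Finset.subset_union_right
  · rintro ⟨ws, -, hws, hc, hΦ, hmax⟩ h
    obtain ⟨r', hr', hsub⟩ := exists_isRepair_superset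
      (fun w hw => hws w (List.mem_toFinset.1 hw)) hc
    refine hΦ ((Φ.holds_congr fun a ha => ?_).1 (h r' hr'))
    refine ⟨fun har => ?_, fun h => hsub h⟩
    obtain ⟨hr, hc', -⟩ := isRepair_iff.1 hr'
    by_contra haw
    refine hmax a ha (hr har) (by simpa using haw) (hc'.mono ?_)
    rw [hins]
    exact Finset.insert_subset har hsub

end Repairs

/-! ### Matching facts with atoms -/

section Matching

variable {S : Schema} {D N : Type} {encD : D → List Bool} {encN : N → List Bool}

theorem getD_argStrings (w : Fact S D N) (j : Fin (S.arity w.rel)) :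
    (argStrings encD encN w).getD j [] = encodeVal encD encN (S.kind w.rel j) (w.args j) := by
  have h : (List.finRange (S.arity w.rel))[(j : ℕ)]'(by simp) = j := by simp
  rw [argStrings, List.getD_eq_getElem _ _ (by simp), List.getElem_map]
  exact congrArg (fun i => encodeVal encD encN (S.kind w.rel i) (w.args i)) h

theorem encodeVal_injective (hD : Injective encD) (hN : Injective encN) (κ : Kind) :
    Injective (encodeVal encD encN κ) := by
  cases κ
  · exact hD
  · exact hN

theorem fact_eq_iff (hD : Injective encD) (hN : Injective encN) {w a : Fact S D N}
    (h : w.rel = a.rel) : w = a ↔ ∀ j : Fin (S.arity a.rel),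
      encodeVal encD encN (S.kind a.rel j) (a.args j) = (argStrings encD encN w).getD j [] := by
  obtain ⟨P, x⟩ := w
  obtain ⟨P', y⟩ := a
  obtain rfl : P = P' := h
  refine ⟨fun h j => ?_, fun h => ?_⟩
  · rw [h]
    exact (getD_argStrings ⟨P, y⟩ j).symm
  · congr 1
    funext j
    exact encodeVal_injective hD hN _
      ((getD_argStrings (encD := encD) (encN := encN) ⟨P, x⟩ j).symm.trans (h j).symm)

theorem exists_encodeVal_eq {w : Fact S D N} {P : S.Rel} (h : w.rel = P) (j : Fin (S.arity P)) :
    ∃ x, encodeVal encD encN (S.kind P j) x = (argStrings encD encN w).getD j [] := by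
  subst h
  exact ⟨_, (getD_argStrings w j).symm⟩

/-- The `j`-th argument of the `i`-th fact of a list of `k` facts followed by the list `cs`. -/
def argTerm (encD : D → List Bool) (encN : N → List Bool) (cs : List (Fact S D N))
    (k i j : ℕ) : StrTerm :=
  if i < k then .arg i j else .const ((cs[i - k]?.elim [] (argStrings encD encN)).getD j [])

theorem argTerm_below (cs : List (Fact S D N)) (k i j : ℕ) :
    (argTerm encD encN cs k i j).Below k := by
  unfold argTerm
  split_ifs with h
  · exact h
  · trivial

theorem eval_argTerm (cs ws : List (Fact S D N)) {k : ℕ} (hk : ws.length = k) (i j : ℕ) :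
    (argTerm encD encN cs k i j).eval encD encN ws =
      ((ws ++ cs)[i]?.elim [] (argStrings encD encN)).getD j [] := by
  unfold argTerm
  split_ifs with h
  · rw [List.getElem?_append_left (by omega)]
    rfl
  · rw [List.getElem?_append_right (by omega), hk]
    rfl

namespace PolyDec

variable {O : List (Symb S) → Symb S → ℕ → Prop} {k : ℕ}
  {dom : List (Fact S D N) → List (Fact S D N) → Prop}

theorem rel_eq_append (cs : List (Fact S D N)) (i : ℕ) (P : S.Rel) :
    PolyDec encD encN O k dom fun _ ws => ∃ w, (ws ++ cs)[i]? = some w ∧ w.rel = P := by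
  by_cases hi : i < k
  · refine (rel_eq hi P).congr (fun _ _ _ _ h => h) fun l ws hk _ _ => ?_
    rw [List.getElem?_append_left (by omega)]
  · refine (const (∃ w, cs[i - k]? = some w ∧ w.rel = P)).congr (fun _ _ _ _ h => h)
      fun l ws hk _ _ => ?_
    rw [List.getElem?_append_right (by omega), hk]

theorem getElem_eq (hD : Injective encD) (hN : Injective encN) {i : ℕ} (hi : i < k)
    (a : Fact S D N) : PolyDec encD encN O k dom fun _ ws => ws[i]? = some a := by
  refine ((rel_eq hi a.rel).and (forall_fintype fun j : Fin (S.arity a.rel) =>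
    str_eq (t := .const (encodeVal encD encN (S.kind a.rel j) (a.args j))) (t' := .arg i j)
    trivial hi)).congr (fun _ _ _ _ h => h) fun l ws hk _ _ => ?_
  rw [List.getElem?_eq_getElem (by omega)]
  simp only [Option.some.injEq, exists_eq_left', StrTerm.eval,
    List.getElem?_eq_getElem (show i < ws.length by omega), Option.elim]
  constructor
  · rintro ⟨h, h'⟩
    exact (fact_eq_iff hD hN h).2 h'
  · intro h
    have h' : ws[i].rel = a.rel := by rw [h]
    exact ⟨h', (fact_eq_iff hD hN h').1 h⟩

theorem mem_facts (hD : Injective encD) (hN : Injective encN) (a : Fact S D N) :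
    PolyDec encD encN O k dom fun _ ws => a ∈ ws := by
  refine (exists_fintype fun i : Fin k => getElem_eq hD hN i.2 a).congr (fun _ _ _ _ h => h)
    fun l ws hk _ _ => ?_
  rw [List.mem_iff_getElem?]
  constructor
  · rintro ⟨i, hi⟩
    exact ⟨i, hi⟩
  · rintro ⟨i, hi⟩
    exact ⟨⟨i, hk ▸ (List.getElem?_eq_some_iff.1 hi).1⟩, hi⟩

theorem mem_input (hD : Injective encD) (hN : Injective encN) (a : Fact S D N) :
    PolyDec encD encN O k dom fun l _ => a ∈ l := by
  refine (exists_mem (getElem_eq hD hN k.lt_succ_self a)).congr (fun _ _ _ _ h => h)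
    fun l ws hk _ _ => ?_
  simp [← hk]

open Classical in
theorem groundSentence_holds [LinearOrder N] (hD : Injective encD) (hN : Injective encN)
    (Φ : GroundSentence S D N) :
    PolyDec encD encN O k dom fun _ ws => Φ.Holds ws.toFinset := by
  induction Φ with
  | fact a =>
    exact (mem_facts hD hN a).congr (fun _ _ _ _ h => h) fun _ _ _ _ _ => List.mem_toFinset.symm
  | builtin b => exact const b.Holds
  | not φ ih => exact ih.not
  | and φ ψ ih ih' => exact ih.and (ih'.congr (fun _ _ _ _ h => h.1) fun _ _ _ _ _ => Iff.rfl)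
  | or φ ψ ih ih' => exact ih.or ih'

end PolyDec

end Matching

section Matching

variable {S : Schema} {D N : Type} {encD : D → List Bool} {encN : N → List Bool}

open Classical in
/-- A string term for a variable that occurs in one of the atoms: the corresponding argument of the
fact matched with the atom. The `p`-th atom is matched with the fact of number `f p`. -/
noncomputable def varTerm (encD : D → List Bool) (encN : N → List Bool) (cs : List (Fact S D N))
    (k : ℕ) (as : List (RelAtom S (Term D N))) (f : Fin as.length → ℕ) (v : Kind × ℕ) : StrTerm :=
  if h : ∃ (p : Fin as.length) (j : Fin (S.arity as[p].rel)), v ∈ (as[p].args j).vars then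
    argTerm encD encN cs k (f h.choose) h.choose_spec.choose
  else .const []

/-- The string term for a term. -/
def strTerm (encD : D → List Bool) (encN : N → List Bool) (g : Kind × ℕ → StrTerm) {κ : Kind} :
    Term D N κ → StrTerm
  | .var n => g (κ, n)
  | .const c => .const (encodeVal encD encN κ c)

theorem strTerm_below {g : Kind × ℕ → StrTerm} {k : ℕ} (hg : ∀ v, (g v).Below k) {κ : Kind}
    (t : Term D N κ) : (strTerm encD encN g t).Below k := by
  cases t with
  | var n => exact hg _
  | const c => trivial

theorem varTerm_below (cs : List (Fact S D N)) (k : ℕ) (as : List (RelAtom S (Term D N)))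
    (f : Fin as.length → ℕ) (v : Kind × ℕ) : (varTerm encD encN cs k as f v).Below k := by
  unfold varTerm
  split_ifs with h
  · exact argTerm_below _ _ _ _
  · trivial

instance [Nonempty D] [Nonempty N] (κ : Kind) : Nonempty (Val D N κ) := by
  cases κ
  · exact ‹Nonempty D›
  · exact ‹Nonempty N›

/-- The valuation with the given representations. -/
noncomputable def decodeValuation [Nonempty D] [Nonempty N] (encD : D → List Bool)
    (encN : N → List Bool) (s : Kind × ℕ → List Bool) : Valuation D N := fun κ n =>
  invFun (encodeVal encD encN κ) (s (κ, n))

theorem encodeVal_decodeValuation [Nonempty D] [Nonempty N] {s : Kind × ℕ → List Bool} {κ : Kind}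
    {n : ℕ} (h : ∃ x, encodeVal encD encN κ x = s (κ, n)) :
    encodeVal encD encN κ (decodeValuation encD encN s κ n) = s (κ, n) :=
  invFun_eq h

theorem encodeVal_subst {g : Kind × ℕ → StrTerm} {ws : List (Fact S D N)} {ρ : Valuation D N}
    {κ : Kind} {t : Term D N κ}
    (h : ∀ v ∈ t.vars, encodeVal encD encN v.1 (ρ v.1 v.2) = (g v).eval encD encN ws) :
    encodeVal encD encN κ (t.subst ρ) = (strTerm encD encN g t).eval encD encN ws := by
  cases t with
  | var n => exact h (κ, n) rfl
  | const c => rfl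

theorem Term.subst_congr {ρ ρ' : Valuation D N} {κ : Kind} {t : Term D N κ}
    (h : ∀ v ∈ t.vars, ρ v.1 v.2 = ρ' v.1 v.2) : t.subst ρ = t.subst ρ' := by
  cases t with
  | var n => exact h (κ, n) rfl
  | const c => rfl

theorem BuiltinAtom.subst_congr {ρ ρ' : Valuation D N} {b : BuiltinAtom (Term D N)}
    (h : ∀ v ∈ b.vars, ρ v.1 v.2 = ρ' v.1 v.2) : b.subst ρ = b.subst ρ' := by
  cases b <;>
    simp only [BuiltinAtom.subst] <;>
    rw [Term.subst_congr fun v hv => h v (Or.inl hv), Term.subst_congr fun v hv => h v (Or.inr hv)]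

theorem exists_arg_of_mem_vars {a : RelAtom S (Term D N)} {v : Kind × ℕ} (h : v ∈ a.vars) :
    ∃ j, v ∈ (a.args j).vars := Set.mem_iUnion.1 h

/-- If a variable occurs in an argument of an atom, its value is given by that argument of any
instance of the atom. -/
theorem encodeVal_of_mem_vars {a : RelAtom S (Term D N)} {j : Fin (S.arity a.rel)} {v : Kind × ℕ}
    (h : v ∈ (a.args j).vars) {s : List Bool} :
    (∀ ρ : Valuation D N, encodeVal encD encN _ ((a.args j).subst ρ) = s →
      encodeVal encD encN v.1 (ρ v.1 v.2) = s) ∧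
    ((∃ x, encodeVal encD encN (S.kind a.rel j) x = s) → ∃ x, encodeVal encD encN v.1 x = s) := by
  generalize a.args j = t at h
  cases t with
  | var n =>
    obtain rfl := h
    exact ⟨fun _ h => h, fun h => h⟩
  | const c => exact absurd h (Set.notMem_empty v)

/-- The `p`-th atom has the relation symbol of the fact it is matched with. -/
def RelMatch (cs : List (Fact S D N)) (as : List (RelAtom S (Term D N))) (f : Fin as.length → ℕ)
    (ws : List (Fact S D N)) : Prop :=
  ∀ p : Fin as.length, ∃ w, (ws ++ cs)[f p]? = some w ∧ w.rel = as[p].rel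

section

variable {cs : List (Fact S D N)} {as : List (RelAtom S (Term D N))} {f : Fin as.length → ℕ}
  {ws : List (Fact S D N)} {k : ℕ}

theorem exists_eq_argTerm (hk : ws.length = k) (h : RelMatch cs as f ws) (p : Fin as.length)
    (j : Fin (S.arity as[p].rel)) : ∃ x : Val D N (S.kind as[p].rel j),
      encodeVal encD encN (S.kind as[p].rel j) x =
      (argTerm encD encN cs k (f p) j).eval encD encN ws := by
  obtain ⟨w, hw, hr⟩ := h p
  obtain ⟨x, hx⟩ := exists_encodeVal_eq (encD := encD) (encN := encN) hr j
  exact ⟨x, by rw [eval_argTerm _ _ hk, hw, hx]; rfl⟩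

theorem getElem?_eq_subst_iff (hD : Injective encD) (hN : Injective encN) (hk : ws.length = k)
    (h : RelMatch cs as f ws) (p : Fin as.length) (ρ : Valuation D N) :
    (ws ++ cs)[f p]? = some (as[p].subst ρ) ↔ ∀ j : Fin (S.arity as[p].rel),
      encodeVal encD encN (S.kind as[p].rel j) ((as[p].args j).subst ρ) =
        (argTerm encD encN cs k (f p) j).eval encD encN ws := by
  obtain ⟨w, hw, hr⟩ := h p
  rw [hw, Option.some_inj, fact_eq_iff (encD := encD) (encN := encN) hD hN
    (a := as[p].subst ρ) hr]
  refine forall_congr' fun j => ?_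
  rw [eval_argTerm _ _ hk, hw]
  rfl

theorem encodeVal_varTerm_of_match (hD : Injective encD) (hN : Injective encN)
    (hk : ws.length = k) (h : RelMatch cs as f ws) {ρ : Valuation D N}
    (hρ : ∀ p : Fin as.length, (ws ++ cs)[f p]? = some (as[p].subst ρ)) {v : Kind × ℕ}
    (hv : ∃ (p : Fin as.length) (j : Fin (S.arity as[p].rel)), v ∈ (as[p].args j).vars) :
    encodeVal encD encN v.1 (ρ v.1 v.2) =
      (varTerm encD encN cs k as f v).eval encD encN ws := by
  rw [varTerm, dif_pos hv]
  exact (encodeVal_of_mem_vars hv.choose_spec.choose_spec).1 ρ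
    ((getElem?_eq_subst_iff hD hN hk h _ ρ).1 (hρ _) _)

theorem exists_eq_varTerm (hk : ws.length = k) (h : RelMatch cs as f ws) {v : Kind × ℕ}
    (hv : ∃ (p : Fin as.length) (j : Fin (S.arity as[p].rel)), v ∈ (as[p].args j).vars) :
    ∃ x, encodeVal encD encN v.1 x = (varTerm encD encN cs k as f v).eval encD encN ws := by
  rw [varTerm, dif_pos hv]
  exact (encodeVal_of_mem_vars hv.choose_spec.choose_spec).2 (exists_eq_argTerm hk h _ _)

end

/-- The valuation read off from the facts with which the atoms are matched. -/
noncomputable def matchValuation [Nonempty D] [Nonempty N] (encD : D → List Bool)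
    (encN : N → List Bool) (cs : List (Fact S D N)) (k : ℕ) (as : List (RelAtom S (Term D N)))
    (f : Fin as.length → ℕ) (ws : List (Fact S D N)) : Valuation D N :=
  decodeValuation encD encN fun v => (varTerm encD encN cs k as f v).eval encD encN ws

theorem exists_valuation_iff [Nonempty D] [Nonempty N] [LinearOrder N] (hD : Injective encD)
    (hN : Injective encN) {cs : List (Fact S D N)} {c : DenialConstraint S D N}
    {f : Fin c.atoms.length → ℕ} {ws : List (Fact S D N)} {k : ℕ} (hk : ws.length = k)
    (h : RelMatch cs c.atoms f ws) :
    (∃ ρ : Valuation D N, (∀ p : Fin c.atoms.length,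
      (ws ++ cs)[f p]? = some (c.atoms[p].subst ρ)) ∧ ∀ b ∈ c.builtins, (b.subst ρ).Holds) ↔
    (∀ (p : Fin c.atoms.length) (j : Fin (S.arity c.atoms[p].rel)),
      (strTerm encD encN (varTerm encD encN cs k c.atoms f) (c.atoms[p].args j)).eval encD encN ws =
        (argTerm encD encN cs k (f p) j).eval encD encN ws) ∧
    ∀ b ∈ c.builtins, (b.subst (matchValuation encD encN cs k c.atoms f ws)).Holds := by
  have hm : ∀ v : Kind × ℕ, (∃ (p : Fin c.atoms.length) (j : Fin (S.arity c.atoms[p].rel)),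
      v ∈ (c.atoms[p].args j).vars) →
      encodeVal encD encN v.1 (matchValuation encD encN cs k c.atoms f ws v.1 v.2) =
        (varTerm encD encN cs k c.atoms f v).eval encD encN ws := fun v hv =>
    encodeVal_decodeValuation (s := fun v => (varTerm encD encN cs k c.atoms f v).eval encD encN ws)
      (exists_eq_varTerm hk h hv)
  have hs : ∀ (p : Fin c.atoms.length) (j : Fin (S.arity c.atoms[p].rel)),
      encodeVal encD encN _ ((c.atoms[p].args j).subst
        (matchValuation encD encN cs k c.atoms f ws)) =
      (strTerm encD encN (varTerm encD encN cs k c.atoms f) (c.atoms[p].args j)).eval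
        encD encN ws := fun p j => encodeVal_subst fun v hv => hm v ⟨p, j, hv⟩
  constructor
  · rintro ⟨ρ, hρ, hb⟩
    have he : ∀ v : Kind × ℕ, (∃ (p : Fin c.atoms.length) (j : Fin (S.arity c.atoms[p].rel)),
        v ∈ (c.atoms[p].args j).vars) →
        ρ v.1 v.2 = matchValuation encD encN cs k c.atoms f ws v.1 v.2 := fun v hv =>
      encodeVal_injective hD hN v.1
        ((encodeVal_varTerm_of_match hD hN hk h hρ hv).trans (hm v hv).symm)
    refine ⟨fun p j => ?_, fun b hbc => ?_⟩
    · rw [← hs, ← Term.subst_congr fun v hv => he v ⟨p, j, hv⟩]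
      exact (getElem?_eq_subst_iff hD hN hk h p ρ).1 (hρ p) j
    · rw [← BuiltinAtom.subst_congr fun v hv => he v ?_]
      · exact hb b hbc
      · obtain ⟨a, ha, hva⟩ := c.safe b hbc v hv
        obtain ⟨p, hp, rfl⟩ := List.getElem_of_mem ha
        obtain ⟨j, hj⟩ := exists_arg_of_mem_vars hva
        exact ⟨⟨p, hp⟩, j, hj⟩
  · rintro ⟨ha, hb⟩
    refine ⟨_, fun p => (getElem?_eq_subst_iff hD hN hk h p _).2 fun j => ?_, hb⟩
    rw [hs, ha]

namespace PolyDec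

variable {O : List (Symb S) → Symb S → ℕ → Prop} {k : ℕ}
  {dom : List (Fact S D N) → List (Fact S D N) → Prop} [LinearOrder N]

/-- The oracle decides the order of `N` in polynomial time. -/
def OrderOracle (encN : N → List Bool) (O : List (Symb S) → Symb S → ℕ → Prop) : Prop :=
  ∃ q : Polynomial ℕ, ∀ x y : N, ∃ b : Bool,
    ∃ t ≤ q.eval ((encN x).length + (encN y).length + 1),
      (b = true ↔ x ≤ y) ∧ O (query S (encN x) (encN y)) (.bit b) t

theorem builtin_holds (hD : Injective encD) (hN : Injective encN) (hO : OrderOracle encN O)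
    {g : Kind × ℕ → StrTerm} (hg : ∀ v, (g v).Below k) (b : BuiltinAtom (Term D N))
    {ρ : List (Fact S D N) → Valuation D N}
    (hρ : ∀ l ws, ws.length = k → dom l ws → ∀ v ∈ b.vars,
      encodeVal encD encN v.1 (ρ ws v.1 v.2) = (g v).eval encD encN ws) :
    PolyDec encD encN O k dom fun _ ws => (b.subst (ρ ws)).Holds := by
  obtain ⟨q, hO⟩ := hO
  have heq : ∀ κ (s t : Term D N κ), (∀ v ∈ s.vars ∪ t.vars, v ∈ b.vars) →
      PolyDec encD encN O k dom fun _ ws => s.subst (ρ ws) = t.subst (ρ ws) := by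
    intro κ s t h
    refine (str_eq (strTerm_below (encD := encD) (encN := encN) hg s)
      (strTerm_below (encD := encD) (encN := encN) hg t)).congr (fun _ _ _ _ h => h)
      fun l ws hk _ hd => ?_
    rw [← encodeVal_subst fun v hv => hρ l ws hk hd v (h v (.inl hv)),
      ← encodeVal_subst fun v hv => hρ l ws hk hd v (h v (.inr hv)),
      (encodeVal_injective hD hN κ).eq_iff]
  have hle : ∀ s t : Term D N .num, (∀ v ∈ s.vars ∪ t.vars, v ∈ b.vars) →
      PolyDec encD encN O k dom fun _ ws => @LE.le N _ (s.subst (ρ ws)) (t.subst (ρ ws)) := by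
    intro s t h
    refine str_le q hO (strTerm_below (encD := encD) (encN := encN) hg s)
      (strTerm_below (encD := encD) (encN := encN) hg t) fun l ws hk hd =>
      ⟨s.subst (ρ ws), t.subst (ρ ws), ?_, ?_, Iff.rfl⟩
    · exact (encodeVal_subst fun v hv => hρ l ws hk hd v (h v (.inl hv))).symm
    · exact (encodeVal_subst fun v hv => hρ l ws hk hd v (h v (.inr hv))).symm
  cases b with
  | eq κ s t => exact heq κ s t fun _ h => h
  | ne κ s t => exact (heq κ s t fun _ h => h).not
  | lt s t =>
    exact (hle t s fun _ h => h.symm).not.congr (fun _ _ _ _ h => h) fun _ _ _ _ _ => not_le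
  | le s t => exact hle s t fun _ h => h
  | gt s t =>
    exact (hle s t fun _ h => h).not.congr (fun _ _ _ _ h => h) fun _ _ _ _ _ => not_le
  | ge s t => exact hle t s fun _ h => h.symm

theorem exists_valuation [Nonempty D] [Nonempty N] (hD : Injective encD) (hN : Injective encN)
    (hO : OrderOracle encN O) (cs : List (Fact S D N)) (c : DenialConstraint S D N)
    (f : Fin c.atoms.length → ℕ) :
    PolyDec encD encN O k dom fun _ ws => ∃ ρ : Valuation D N, (∀ p : Fin c.atoms.length,
      (ws ++ cs)[f p]? = some (c.atoms[p].subst ρ)) ∧ ∀ b ∈ c.builtins, (b.subst ρ).Holds := by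
  have h₁ : PolyDec encD encN O k dom fun _ ws => RelMatch cs c.atoms f ws :=
    forall_fintype fun p => rel_eq_append cs (f p) c.atoms[p].rel
  have h₂ : PolyDec encD encN O k (fun l ws => dom l ws ∧ RelMatch cs c.atoms f ws)
      fun _ ws => ∀ (p : Fin c.atoms.length) (j : Fin (S.arity c.atoms[p].rel)),
        (strTerm encD encN (varTerm encD encN cs k c.atoms f) (c.atoms[p].args j)).eval
          encD encN ws = (argTerm encD encN cs k (f p) j).eval encD encN ws :=
    forall_fintype fun p => forall_fintype fun j => str_eq
      (strTerm_below (varTerm_below _ _ _ _) _) (argTerm_below _ _ _ _)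
  have h₃ : PolyDec encD encN O k (fun l ws => dom l ws ∧ RelMatch cs c.atoms f ws)
      fun _ ws => ¬ ∃ b ∈ c.builtins,
        ¬ (b.subst (matchValuation encD encN cs k c.atoms f ws)).Holds := by
    refine (exists_mem_list c.builtins fun b hb => (builtin_holds hD hN hO
      (varTerm_below (encD := encD) (encN := encN) cs k c.atoms f) b fun l ws hk hd v hv => ?_).not).not
    obtain ⟨a, ha, hva⟩ := c.safe b hb v hv
    obtain ⟨p, hp, rfl⟩ := List.getElem_of_mem ha
    obtain ⟨j, hj⟩ := exists_arg_of_mem_vars hva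
    exact encodeVal_decodeValuation
      (s := fun v => (varTerm encD encN cs k c.atoms f v).eval encD encN ws)
      (exists_eq_varTerm hk hd.2 ⟨⟨p, hp⟩, j, hj⟩)
  refine (h₁.and (h₂.and (h₃.congr (fun _ _ _ _ h => h.1) fun _ _ _ _ _ => Iff.rfl))).congr
    (fun _ _ _ _ h => h) fun l ws hk _ _ => ⟨fun h => ?_, fun h => ?_⟩
  · exact (exists_valuation_iff hD hN hk h.1).2 ⟨h.2.1, by simpa using h.2.2⟩
  · have hR : RelMatch cs c.atoms f ws := by
      obtain ⟨ρ, hρ, -⟩ := h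
      exact fun p => ⟨_, hρ p, rfl⟩
    have := (exists_valuation_iff hD hN hk hR).1 h
    exact ⟨hR, this.1, by simpa using this.2⟩

open Classical in
theorem consistent [Nonempty D] [Nonempty N] (hD : Injective encD) (hN : Injective encN)
    (hO : OrderOracle encN O) (F : Finset (DenialConstraint S D N)) (cs : List (Fact S D N)) :
    PolyDec encD encN O k dom fun _ ws => Consistent F (ws ++ cs).toFinset := by
  refine (forall_mem_finset F fun c _ => (exists_fintype
    fun f : Fin c.atoms.length → Fin (k + cs.length) =>
      exists_valuation hD hN hO cs c fun p => f p).not).congr (fun _ _ _ _ h => h)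
    fun l ws hk _ _ => forall₂_congr fun c _ => ?_
  rw [DenialConstraint.Holds, ← not_exists, not_congr]
  constructor
  · rintro ⟨f, ρ, hρ, hb⟩
    refine ⟨ρ, fun a ha => ?_, hb⟩
    obtain ⟨p, hp, rfl⟩ := List.getElem_of_mem ha
    exact List.mem_toFinset.2 (List.mem_of_getElem? (hρ ⟨p, hp⟩))
  · rintro ⟨ρ, hρ, hb⟩
    have : ∀ p : Fin c.atoms.length, ∃ i : Fin (k + cs.length),
        (ws ++ cs)[(i : ℕ)]? = some (c.atoms[p].subst ρ) := by
      intro p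
      obtain ⟨i, hi, he⟩ := List.getElem_of_mem
        (List.mem_toFinset.1 (hρ c.atoms[p] (List.getElem_mem p.2)))
      rw [List.length_append, hk] at hi
      exact ⟨⟨i, hi⟩, List.getElem?_eq_some_iff.2 ⟨_, he⟩⟩
    choose f hf using this
    exact ⟨f, ρ, hf, hb⟩

open Classical in
theorem mem_consistentAnswers [Nonempty D] [Nonempty N] (hD : Injective encD)
    (hN : Injective encN) (hO : OrderOracle encN O) (F : Finset (DenialConstraint S D N))
    (Φ : GroundSentence S D N) : PolyDec encD encN O 0 (fun _ _ => True)
      fun l _ => l.toFinset ∈ consistentAnswers F Φ := by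
  obtain ⟨K, hK⟩ := exists_bound_certificate F Φ
  have hQ : ∀ j : Fin K, PolyDec encD encN O (0 + j) (fun _ _ => True) fun l ws =>
      Consistent F (ws ++ []).toFinset ∧ ¬ Φ.Holds ws.toFinset ∧
        ∀ a ∈ Φ.facts, a ∈ l → ¬ a ∈ ws → ¬ Consistent F (ws ++ [a]).toFinset := fun j =>
    (consistent hD hN hO F []).and ((groundSentence_holds hD hN Φ).not.and
      (forall_mem_finset _ fun a _ => (mem_input hD hN a).imp ((mem_facts hD hN a).not.imp
        (consistent hD hN hO F [a]).not)))
  refine (exists_fintype fun j => exists_list (hQ j)).not.congr (fun _ _ _ _ h => h)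
    fun l ws hk _ _ => ?_
  rw [← not_iff_not, not_not, hK]
  obtain rfl := List.length_eq_zero_iff.1 hk
  constructor
  · rintro ⟨j, vs, hj, hl, hc, hΦ, h⟩
    exact ⟨vs, hj ▸ j.2, fun v hv => List.mem_toFinset.2 (hl v hv), by simpa using hc,
      by simpa using hΦ, fun a ha hal hav => by
        simpa using h a ha (List.mem_toFinset.1 hal) (by simpa using hav)⟩
  · rintro ⟨vs, hj, hl, hc, hΦ, h⟩
    exact ⟨⟨vs.length, hj⟩, vs, rfl, fun v hv => List.mem_toFinset.1 (hl v hv), by simpa using hc,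
      by simpa using hΦ, fun a ha hal hav => by
        simpa using h a ha (List.mem_toFinset.2 hal) (by simpa using hav)⟩

end PolyDec

/-- A predicate of instances decided by a program with the oracle of a Turing machine is in
PTIME. -/
theorem PolyDec.instancesInPTIME (M : Turing.FinTM2) (inp : Symb S → M.Γ M.k₀)
    (outp : M.Γ M.k₁ → Symb S) {A : Set (Instance S D N)}
    (h : open Classical in PolyDec encD encN (Compile.oracle M inp outp) 0 (fun _ _ => True)
      fun l _ => l.toFinset ∈ A) : InstancesInPTIME encD encN A := by
  obtain ⟨p, q, h⟩ := h
  refine Compile.inPTIME_of_runs M inp outp _ _ (.seq p (.clear 0)) Symb.isTrue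
    (q + (2 * .X + 1)) fun l => ?_
  obtain ⟨b, hb, hr⟩ := h l [] rfl (by simp) trivial (update (fun _ => []) 0
    (encodeFacts encD encN l)) ⟨by simp, by simp, fun r hr => by
      rw [update_of_ne (by simpa using Nat.ne_of_gt hr)]⟩
  refine ⟨.bit b, hb, (hr.seq (Prog.runs_clear _ _)).of_eq ?_ (by simp)⟩
  funext r
  simp only [update_apply]
  grind

end Matching

end CQA

/-- Fix a schema `S`, an infinite domain `D` of uninterpreted constants and a numeric domain `N`,
both with values written as binary strings, the order of `N` being decidable in polynomial time.
For every finite set `F` of denial constraints and every quantifier-free sentence `Φ`, the set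
`D_{F,Φ}` of the instances in which `Φ` is consistently true is in PTIME. -/
theorem mainTheorem1 (S : CQA.Schema) (D N : Type) [Infinite D] [Nonempty N] [LinearOrder N]
    (encD : D → List Bool) (hencD : Function.Injective encD)
    (encN : N → List Bool) (hencN : Function.Injective encN)
    (hle : CQA.InPTIME (CQA.encodePair encN) {p : N × N | p.1 ≤ p.2})
    (F : Finset (CQA.DenialConstraint S D N)) (Φ : CQA.GroundSentence S D N) :
    CQA.InstancesInPTIME encD encN (CQA.consistentAnswers F Φ) := by
  classical
  obtain ⟨M⟩ := hle
  let toOpt : CQA.Symb S → Option Bool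
    | .bit b => some b
    | _ => none
  refine CQA.PolyDec.instancesInPTIME M.tm (fun g => M.inputAlphabet.symm (toOpt g))
    (fun o => .bit (M.outputAlphabet o))
    (CQA.PolyDec.mem_consistentAnswers hencD hencN ⟨.X + M.time + 2, fun x y => ?_⟩ F Φ)
  have hlen : (encN x).length + (encN y).length + 1 =
      (CQA.encodePair encN (x, y)).length := by
    simp [CQA.encodePair]
    omega
  have hq : (CQA.PolyDec.query S (encN x) (encN y)).length = (CQA.encodePair encN (x, y)).length := by
    rw [← hlen]
    simp [CQA.PolyDec.query]
    omega
  have hin : (CQA.PolyDec.query S (encN x) (encN y)).reverse.map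
      (fun g => M.inputAlphabet.symm (toOpt g)) =
      (CQA.encodePair encN (x, y)).map M.inputAlphabet.invFun := by
    simp [CQA.PolyDec.query, CQA.encodePair, toOpt, Function.comp_def]
  refine ⟨decide (x ≤ y), _, ?_, by simp, M.outputAlphabet.symm (decide (x ≤ y)),
    M.time.eval (CQA.encodePair encN (x, y)).length, ⟨?_⟩, by simp, rfl⟩
  · rw [hlen, hq]
    simp
  · rw [hin]
    have := M.outputsFun (x, y)
    convert this using 1
    simp [Computability.encodeBool]
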